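/- Let $k$ be a field of characteristic zero, $v$ an indeterminate, and let $\mathbf U$ be the $k(v)$-algebra generated by $E,F,K^{\pm1}$ with relations $KK^{-1}=K^{-1}K=1$, $KEK^{-1}=v^2E$, $KFK^{-1}=v^{-2}F$, $EF-FE=\frac{K-K^{-1}}{v-v^{-1}}$. Let $R=k(v)[[T-1]]$, let $s$ be the involution of $R$ over $k(v)$ with $s(T)=T^{-1}$, and put ${}_R\mathbf U=R\otimes_{k(v)}\mathbf U$. Write $[n]=\frac{v^n-v^{-n}}{v-v^{-1}}$, $[n]!=[n][n-1]\cdots[1]$, $\{n\}=\prod_{a=1}^n(v^a-v^{-a})$, $x^{(n)}=x^n/[n]!$, $[T;r]=\frac{v^rT-v^{-r}T^{-1}}{v-v^{-1}}$ and $[T;r]_{(j)}=[T;r][T;r-1]\cdots[T;r-j+1]$. Let $\rho_1$ and $T'_{-1}$ be the automorphisms of $\mathbf U$ with $\rho_1(E)=-vF$, $\rho_1(F)=-v^{-1}E$, $\rho_1(K)=K^{-1}$ and $T'_{-1}(E)=-K^{-1}F$, $T'_{-1}(F)=-EK$, $T'_{-1}(K)=K^{-1}$, and let $\varrho$ be the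 anti-automorphism with $\varrho(E)=vKF$, $\varrho(F)=vK^{-1}E$, $\varrho(K)=K$. An $R$-bilinear form $\phi$ is called $\varrho$-invariant if $\phi(ua,b)=\phi(a,\varrho(u)b)$ for all $u\in\mathbf U$. For an ${}_R\mathbf U$-module $A$ let $A_F$ be its localization with respect to the powers of $F$, $\iota:A\to A_F$ the canonical map, $A_\pi=A_F/\iota A$, let $A^{sT'_{-1}}$ be $A$ with the action composed with $s\otimes T'_{-1}$, and $A^{\rho_1}$ be $A$ with the action composed with $\rho_1$. Let $M$ be the ${}_R\mathbf U$-Verma module of highest weight $Tv^{-1}$, let $w$ be a highest weight vector generating $M$, and let $m\in M_\pi$ be the class of $F^{-1}w$. (1) There is a unique $\varrho$-invariant form $\phi:M\times M\to R$ with $\phi(w,w)=1$ (the Shapovalov form), and a unique isomorphism of ${}_R\mathbf U$-modules $\Psi:(M_\pi)^{sT'_{-1}}\to M$ with $$\Psi(F^{-j}m)=\frac{(-1)^jv^{-j^2}T^j}{[j]!\,[T;-1]_{(j)}}F^jw\qquad(j\ge0).$$ (2) There is a unique $\varrho$-invariant form $\phi_F:M_F\times M_F\to R$ (the lift of $\phi$)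 that vanishes on $\iota M\times M_F$ and on $M_F\times\iota M$ and satisfies $\phi_F(F^{-1}a,F^{-1}b)=\phi(a,b)$ for all $a,b\in M$ of weight $Tv^{-1}$ with $Ea=Eb=0$. Let $\phi_\pi:M_\pi\times M_\pi\to R$ be the form it induces. (3) Let $L$ be the $R$-linear endomorphism of $M_\pi\otimes_RM_\pi^{\rho_1}$ given by $$L(a\otimes b)=\sum_{n\ge0}(-1)^nv^{-n(n-1)/2}\{n\}\,F^{(n)}a\otimes E^{(n)}b,$$ where $E^{(n)}$ acts on $M_\pi^{\rho_1}$ by the twisted action (the sum is finite, as $F$ acts locally nilpotently on $M_\pi$), and view $\phi_\pi$ as a linear map $M_\pi\otimes_R M_\pi^{\rho_1}\to R$. Then $$s\circ\phi_\pi\circ L=\phi\circ(\Psi\otimes\Psi).$$ In other words, the form $\phi^\sharp$ on $M$ determined by $\phi^\sharp(\Psi(a),\Psi(b))=s(\phi_\pi(L(a\otimes b)))$ for $a,b\in M_\pi$ satisfies $\phi^\sharp=\phi$. -/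

import Mathlib

open scoped TensorProduct OreLocalization

universe u

noncomputable section

namespace QSL2

/-! ## The quantized enveloping algebra of `sl(2)` over `k(v)` -/

section Algebra

variable (k : Type u) [Field k]

/-- The indeterminate `v` of `k(v)`. -/
abbrev v : RatFunc k := RatFunc.X

/-- The generators `E`, `F`, `K`, `K⁻¹`. -/
inductive Gen : Type
  | E | F | K | Kinv

/-- The defining relations. -/
inductive Rel : FreeAlgebra (RatFunc k) Gen → FreeAlgebra (RatFunc k) Gen → Prop
  | K_Kinv : Rel (FreeAlgebra.ι _ Gen.K * FreeAlgebra.ι _ Gen.Kinv) 1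
  | Kinv_K : Rel (FreeAlgebra.ι _ Gen.Kinv * FreeAlgebra.ι _ Gen.K) 1
  | K_E : Rel (FreeAlgebra.ι _ Gen.K * FreeAlgebra.ι _ Gen.E * FreeAlgebra.ι _ Gen.Kinv)
      (v k ^ 2 • FreeAlgebra.ι _ Gen.E)
  | K_F : Rel (FreeAlgebra.ι _ Gen.K * FreeAlgebra.ι _ Gen.F * FreeAlgebra.ι _ Gen.Kinv)
      ((v k ^ 2)⁻¹ • FreeAlgebra.ι _ Gen.F)
  | E_F : Rel (FreeAlgebra.ι _ Gen.E * FreeAlgebra.ι _ Gen.F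
        - FreeAlgebra.ι _ Gen.F * FreeAlgebra.ι _ Gen.E)
      ((v k - (v k)⁻¹)⁻¹ • (FreeAlgebra.ι _ Gen.K - FreeAlgebra.ι _ Gen.Kinv))

/-- The quantized enveloping algebra `U` over `k(v)`. -/
def U : Type u := RingQuot (Rel k)

instance : Ring (U k) := inferInstanceAs (Ring (RingQuot (Rel k)))

instance : Algebra (RatFunc k) (U k) := inferInstanceAs (Algebra (RatFunc k) (RingQuot (Rel k)))

/-- The projection of the free algebra onto `U`. -/
def mkU : FreeAlgebra (RatFunc k) Gen →ₐ[RatFunc k] U k := RingQuot.mkAlgHom (RatFunc k) (Rel k)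

theorem mkU_surjective : Function.Surjective (mkU k) :=
  RingQuot.mkAlgHom_surjective (RatFunc k) (Rel k)

theorem mkU_rel {x y : FreeAlgebra (RatFunc k) Gen} (h : Rel k x y) : mkU k x = mkU k y :=
  RingQuot.mkAlgHom_rel (RatFunc k) h

/-- The image of a generator in `U`. -/
def gen (g : Gen) : U k := mkU k (FreeAlgebra.ι _ g)

abbrev E : U k := gen k Gen.E
abbrev F : U k := gen k Gen.F
abbrev K : U k := gen k Gen.K
abbrev Kinv : U k := gen k Gen.Kinv

theorem K_mul_Kinv : K k * Kinv k = 1 := by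
  simpa [gen] using mkU_rel k (Rel.K_Kinv (k := k))

theorem Kinv_mul_K : Kinv k * K k = 1 := by
  simpa [gen] using mkU_rel k (Rel.Kinv_K (k := k))

theorem K_mul_E_mul_Kinv : K k * E k * Kinv k = v k ^ 2 • E k := by
  simpa [gen] using mkU_rel k (Rel.K_E (k := k))

theorem K_mul_F_mul_Kinv : K k * F k * Kinv k = (v k ^ 2)⁻¹ • F k := by
  simpa [gen] using mkU_rel k (Rel.K_F (k := k))

theorem E_mul_F_sub : E k * F k - F k * E k = (v k - (v k)⁻¹)⁻¹ • (K k - Kinv k) := by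
  simpa [gen] using mkU_rel k (Rel.E_F (k := k))

/-- The images of the generators under an algebra map to be defined on `U`. -/
def genVal {A : Type*} (e f κ κ' : A) : Gen → A
  | Gen.E => e
  | Gen.F => f
  | Gen.K => κ
  | Gen.Kinv => κ'

/-- The algebra homomorphism out of `U` determined by images of the generators that satisfy
the defining relations. -/
def liftU {A : Type*} [Ring A] [Algebra (RatFunc k) A] (e f κ κ' : A)
    (h1 : κ * κ' = 1) (h2 : κ' * κ = 1) (h3 : κ * e * κ' = v k ^ 2 • e)
    (h4 : κ * f * κ' = (v k ^ 2)⁻¹ • f)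
    (h5 : e * f - f * e = (v k - (v k)⁻¹)⁻¹ • (κ - κ')) : U k →ₐ[RatFunc k] A :=
  RingQuot.liftAlgHom (RatFunc k) ⟨FreeAlgebra.lift (RatFunc k) (genVal e f κ κ'), by
    intro x y h
    cases h <;> simp [genVal, h1, h2, h3, h4, h5]⟩

theorem liftU_gen {A : Type*} [Ring A] [Algebra (RatFunc k) A] (e f κ κ' : A)
    (h1 : κ * κ' = 1) (h2 : κ' * κ = 1) (h3 : κ * e * κ' = v k ^ 2 • e)
    (h4 : κ * f * κ' = (v k ^ 2)⁻¹ • f)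
    (h5 : e * f - f * e = (v k - (v k)⁻¹)⁻¹ • (κ - κ')) (g : Gen) :
    liftU k e f κ κ' h1 h2 h3 h4 h5 (gen k g) = genVal e f κ κ' g :=
  (RingQuot.liftAlgHom_mkAlgHom_apply (RatFunc k) (FreeAlgebra.lift (RatFunc k) (genVal e f κ κ'))
    _ (FreeAlgebra.ι _ g)).trans (FreeAlgebra.lift_ι_apply _ _)

theorem v_ne_zero : v k ≠ 0 := RatFunc.X_ne_zero

theorem E_mul_Kinv : E k * Kinv k = v k ^ 2 • (Kinv k * E k) := by
  have h := congrArg (fun x => Kinv k * x) (K_mul_E_mul_Kinv k)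
  simpa only [← mul_assoc, Kinv_mul_K, one_mul, mul_smul_comm] using h

theorem F_mul_Kinv : F k * Kinv k = (v k ^ 2)⁻¹ • (Kinv k * F k) := by
  have h := congrArg (fun x => Kinv k * x) (K_mul_F_mul_Kinv k)
  simpa only [← mul_assoc, Kinv_mul_K, one_mul, mul_smul_comm] using h

theorem K_mul_E : K k * E k = v k ^ 2 • (E k * K k) := by
  have h := congrArg (fun x => x * K k) (K_mul_E_mul_Kinv k)
  simpa only [mul_assoc, Kinv_mul_K, mul_one, smul_mul_assoc] using h

theorem K_mul_F : K k * F k = (v k ^ 2)⁻¹ • (F k * K k) := by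
  have h := congrArg (fun x => x * K k) (K_mul_F_mul_Kinv k)
  simpa only [mul_assoc, Kinv_mul_K, mul_one, smul_mul_assoc] using h

theorem Kinv_mul_E : Kinv k * E k = (v k ^ 2)⁻¹ • (E k * Kinv k) := by
  rw [E_mul_Kinv, smul_smul, inv_mul_cancel₀ (pow_ne_zero 2 (v_ne_zero k)), one_smul]

theorem Kinv_mul_F : Kinv k * F k = v k ^ 2 • (F k * Kinv k) := by
  rw [F_mul_Kinv, smul_smul, mul_inv_cancel₀ (pow_ne_zero 2 (v_ne_zero k)), one_smul]

theorem Kinv_E_K : Kinv k * E k * K k = (v k ^ 2)⁻¹ • E k := by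
  rw [Kinv_mul_E, smul_mul_assoc, mul_assoc, Kinv_mul_K, mul_one]

theorem Kinv_F_K : Kinv k * F k * K k = v k ^ 2 • F k := by
  rw [Kinv_mul_F, smul_mul_assoc, mul_assoc, Kinv_mul_K, mul_one]

/-- The automorphism `ρ₁` of `U`: `E ↦ -v F`, `F ↦ -v⁻¹ E`, `K ↦ K⁻¹`. -/
def rho1 : U k →ₐ[RatFunc k] U k :=
  liftU k (-(v k • F k)) (-((v k)⁻¹ • E k)) (Kinv k) (K k)
    (Kinv_mul_K k) (K_mul_Kinv k)
    (by
      rw [mul_neg, neg_mul, mul_smul_comm, smul_mul_assoc, Kinv_F_K, smul_neg, smul_comm])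
    (by
      rw [mul_neg, neg_mul, mul_smul_comm, smul_mul_assoc, Kinv_E_K, smul_neg, smul_comm])
    (by
      have hv := v_ne_zero k
      rw [neg_mul_neg, neg_mul_neg, smul_mul_smul_comm, smul_mul_smul_comm,
        mul_inv_cancel₀ hv, inv_mul_cancel₀ hv, one_smul, one_smul, ← neg_sub, E_mul_F_sub,
        ← smul_neg, neg_sub])

/-- The automorphism `T'₋₁` of `U`: `E ↦ -K⁻¹ F`, `F ↦ -E K`, `K ↦ K⁻¹`. -/
def Tprime : U k →ₐ[RatFunc k] U k :=
  liftU k (-(Kinv k * F k)) (-(E k * K k)) (Kinv k) (K k)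
    (Kinv_mul_K k) (K_mul_Kinv k)
    (by
      rw [mul_neg, neg_mul, mul_assoc, mul_assoc (Kinv k), ← mul_assoc (Kinv k) (F k), Kinv_F_K,
        mul_smul_comm, smul_neg])
    (by
      rw [mul_neg, neg_mul, ← mul_assoc, Kinv_E_K, smul_mul_assoc, smul_neg])
    (by
      have h1 : Kinv k * F k * (E k * K k) = F k * E k := by
        rw [Kinv_mul_F, smul_mul_assoc, mul_assoc, ← mul_assoc (Kinv k), Kinv_E_K,
          mul_smul_comm, smul_smul, mul_inv_cancel₀ (pow_ne_zero 2 (v_ne_zero k)), one_smul]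
      have h2 : E k * K k * (Kinv k * F k) = E k * F k := by
        rw [mul_assoc, ← mul_assoc (K k), K_mul_Kinv, one_mul]
      rw [neg_mul_neg, neg_mul_neg, h1, h2, ← neg_sub, E_mul_F_sub, ← smul_neg, neg_sub])

/-- The anti-automorphism `ϱ` of `U`: `E ↦ v K F`, `F ↦ v K⁻¹ E`, `K ↦ K`. -/
def rho : U k →ₐ[RatFunc k] (U k)ᵐᵒᵖ :=
  liftU k (MulOpposite.op (v k • (K k * F k))) (MulOpposite.op (v k • (Kinv k * E k)))
    (MulOpposite.op (K k)) (MulOpposite.op (Kinv k))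
    (by rw [← MulOpposite.op_mul, Kinv_mul_K, MulOpposite.op_one])
    (by rw [← MulOpposite.op_mul, K_mul_Kinv, MulOpposite.op_one])
    (by
      rw [← MulOpposite.op_mul, ← MulOpposite.op_mul, ← MulOpposite.op_smul]
      congr 1
      rw [smul_mul_assoc, mul_smul_comm, mul_assoc, ← mul_assoc (Kinv k), Kinv_mul_K, one_mul,
        K_mul_F, smul_comm, smul_smul (v k ^ 2), mul_inv_cancel₀ (pow_ne_zero 2 (v_ne_zero k)),
        one_smul])
    (by
      rw [← MulOpposite.op_mul, ← MulOpposite.op_mul, ← MulOpposite.op_smul]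
      congr 1
      rw [smul_mul_assoc, mul_smul_comm, mul_assoc, ← mul_assoc (Kinv k) (E k), Kinv_E_K, mul_smul_comm, smul_comm])
    (by
      have hv := pow_ne_zero 2 (v_ne_zero k)
      have h1 : Kinv k * E k * (K k * F k) = (v k ^ 2)⁻¹ • (E k * F k) := by
        rw [← mul_assoc, Kinv_E_K, smul_mul_assoc]
      have h2 : K k * F k * (Kinv k * E k) = (v k ^ 2)⁻¹ • (F k * E k) := by
        rw [← mul_assoc, K_mul_F_mul_Kinv, smul_mul_assoc]
      rw [← MulOpposite.op_mul, ← MulOpposite.op_mul, ← MulOpposite.op_sub,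
        ← MulOpposite.op_sub, ← MulOpposite.op_smul]
      congr 1
      rw [smul_mul_smul_comm, smul_mul_smul_comm, h1, h2, smul_smul, smul_smul,
        ← pow_two, mul_inv_cancel₀ hv, one_smul, one_smul, E_mul_F_sub])

/-! ## Quantum integers and divided powers -/

/-- `[n] = (vⁿ - v⁻ⁿ) / (v - v⁻¹)`. -/
def qInt (n : ℤ) : RatFunc k := (v k ^ n - v k ^ (-n)) / (v k - (v k)⁻¹)

/-- `[n]! = [n][n-1]⋯[1]`. -/
def qFact (n : ℕ) : RatFunc k := ∏ i ∈ Finset.range n, qInt k (i + 1)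

/-- `{n} = ∏_{a=1}^n (vᵃ - v⁻ᵃ)`. -/
def qBrace (n : ℕ) : RatFunc k := ∏ a ∈ Finset.Icc 1 n, (v k ^ a - (v k ^ a)⁻¹)

/-- The divided power `x⁽ⁿ⁾ = xⁿ / [n]!`. -/
def divPow (x : U k) (n : ℕ) : U k := (qFact k n)⁻¹ • x ^ n

/-! ## The base ring `R = k(v)[[T - 1]]` -/

/-- `R = k(v)[[T - 1]]`, the variable of the power series ring being `T - 1`. -/
abbrev R : Type u := PowerSeries (RatFunc k)

/-- The element `T` of `R`. -/
def T : R k := 1 + PowerSeries.X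

theorem hasSubst_Tinv : PowerSeries.HasSubst ((T k)⁻¹ - 1 : R k) :=
  PowerSeries.HasSubst.of_constantCoeff_zero' (by simp [T])

/-- The involution `s` of `R` with `T ↦ T⁻¹`, i.e. the substitution of `T⁻¹ - 1` for `T - 1`. -/
def s : R k →ₐ[RatFunc k] R k := PowerSeries.substAlgHom (hasSubst_Tinv k)

theorem s_T : s k (T k) = (T k)⁻¹ := by
  have h : s k PowerSeries.X = (T k)⁻¹ - 1 := by
    rw [s, PowerSeries.coe_substAlgHom]
    exact PowerSeries.subst_X (hasSubst_Tinv k)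
  rw [T, map_add, map_one, h, T, add_sub_cancel]

/-- `[T; r] = (vʳ T - v⁻ʳ T⁻¹) / (v - v⁻¹)`. -/
def qT (r : ℤ) : R k := (v k - (v k)⁻¹)⁻¹ • (v k ^ r • T k - v k ^ (-r) • (T k)⁻¹)

/-- `[T; r]_{(j)} = [T; r][T; r-1]⋯[T; r-j+1]`. -/
def qTFalling (r : ℤ) (j : ℕ) : R k := ∏ i ∈ Finset.range j, qT k (r - i)

/-! ## The extension of scalars `_R U` -/

/-- `_R U = R ⊗_{k(v)} U`. -/
abbrev UR : Type u := R k ⊗[RatFunc k] U k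

/-- The canonical map `U → _R U`. -/
abbrev inU : U k →ₐ[RatFunc k] UR k := Algebra.TensorProduct.includeRight

/-- The `R`-linear extension of `ρ₁`. -/
def rho1R : UR k →ₐ[R k] UR k := Algebra.TensorProduct.map (AlgHom.id (R k) (R k)) (rho1 k)

/-- The automorphism `s ⊗ T'₋₁` of `_R U`. -/
def sTprime : UR k →ₐ[RatFunc k] UR k := Algebra.TensorProduct.map (s k) (Tprime k)

end Algebra

/-! ## Twisted modules -/

section Twist

variable {k : Type u} [Field k]

/-- The module `A` with the action of `_R U` composed with `σ`. -/
def Twist (_σ : UR k →+* UR k) (A : Type u) : Type u := A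

variable (σ : UR k →+* UR k) (A : Type u) [AddCommGroup A] [Module (UR k) A]

instance : AddCommGroup (Twist σ A) := inferInstanceAs (AddCommGroup A)

instance : Module (UR k) (Twist σ A) := Module.compHom A σ

/-- `R` acts on a twisted module through `R → _R U`. -/
instance : Module (R k) (Twist σ A) := Module.compHom (Twist σ A) (algebraMap (R k) (UR k))

instance : IsScalarTower (R k) (UR k) (Twist σ A) :=
  ⟨fun r x a => by
    change (r • x) • a = algebraMap (R k) (UR k) r • x • a
    rw [Algebra.smul_def r x, mul_smul]⟩

/-- The identity map from `A` to its twist. -/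
def toTwist : A ≃+ Twist σ A := AddEquiv.refl A

theorem smul_toTwist (x : UR k) (a : A) : x • toTwist σ A a = toTwist σ A (σ x • a) := rfl

/-- `ρ₁` fixes `R`, so the identity map from `A` to `A^{ρ₁}` is `R`-linear. -/
def toTwistRho1 [Module (R k) A] [IsScalarTower (R k) (UR k) A] :
    A ≃ₗ[R k] Twist (rho1R k : UR k →+* UR k) A where
  __ := toTwist (rho1R k : UR k →+* UR k) A
  map_smul' r a := by
    change r • a = (rho1R k) (algebraMap (R k) (UR k) r) • a
    rw [AlgHom.commutes, algebraMap_smul]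

end Twist

/-! ## Localization with respect to the powers of `F` -/

section Localization

variable (k : Type u) [Field k]

/-- The multiplicative set generated by `F`. -/
abbrev FPow : Submonoid (UR k) := Submonoid.powers (inU k (F k))

/-- `r` is killed by a product of operators `x ↦ F x - c x F` with `c ∈ k(v)`. -/
inductive AdNil : UR k → Prop
  | zero : AdNil 0
  | step (c : RatFunc k) (r : UR k)
      (h : AdNil (inU k (F k) * r - c • (r * inU k (F k)))) : AdNil r

variable {k}

theorem AdNil.sub_smul (c : RatFunc k) {r : UR k} (h : AdNil k r) :
    AdNil k (inU k (F k) * r - c • (r * inU k (F k))) := by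
  induction h with
  | zero => simpa using AdNil.zero
  | step d r _ ih =>
    refine AdNil.step d _ ?_
    convert ih using 1
    simp only [mul_sub, sub_mul, mul_smul_comm, smul_mul_assoc, smul_sub, mul_assoc]
    rw [smul_comm c d]
    abel

theorem AdNil.add {r r' : UR k} (h : AdNil k r) (h' : AdNil k r') : AdNil k (r + r') := by
  induction h generalizing r' with
  | zero => simpa using h'
  | step c r _ ih =>
    refine AdNil.step c _ ?_
    convert ih (h'.sub_smul c) using 1
    rw [mul_add, add_mul, smul_add]
    abel

theorem AdNil.smul (a : R k) {r : UR k} (h : AdNil k r) : AdNil k (a • r) := by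
  induction h with
  | zero => simpa using AdNil.zero
  | step c r _ ih =>
    refine AdNil.step c _ ?_
    convert ih using 1
    rw [mul_smul_comm, smul_mul_assoc, smul_sub, smul_comm c a]

theorem AdNil.F_mul {r : UR k} (h : AdNil k r) : AdNil k (inU k (F k) * r) := by
  simpa using h.sub_smul 0

theorem AdNil.skew_mul {x : UR k} {a : RatFunc k}
    (hx : inU k (F k) * x = a • (x * inU k (F k))) {r : UR k} (h : AdNil k r) : AdNil k (x * r) := by
  induction h with
  | zero => simpa using AdNil.zero
  | step c r _ ih =>
    refine AdNil.step (a * c) _ ?_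
    have : inU k (F k) * (x * r) - (a * c) • (x * r * inU k (F k))
        = (algebraMap (RatFunc k) (R k) a) •
          (x * (inU k (F k) * r - c • (r * inU k (F k)))) := by
      rw [algebraMap_smul, ← mul_assoc, hx, mul_sub, smul_sub, mul_smul_comm, smul_smul,
        smul_mul_assoc, mul_assoc, mul_assoc]
    rw [this]
    exact ih.smul _

theorem inU_F_mul_K : inU k (F k) * inU k (K k) = v k ^ 2 • (inU k (K k) * inU k (F k)) := by
  rw [← map_mul, ← map_mul, ← map_smul, K_mul_F, smul_smul,
    mul_inv_cancel₀ (pow_ne_zero 2 (v_ne_zero k)), one_smul]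

theorem inU_F_mul_Kinv :
    inU k (F k) * inU k (Kinv k) = (v k ^ 2)⁻¹ • (inU k (Kinv k) * inU k (F k)) := by
  rw [← map_mul, ← map_mul, ← map_smul, F_mul_Kinv]

theorem AdNil.K_mul {r : UR k} (h : AdNil k r) : AdNil k (inU k (K k) * r) :=
  h.skew_mul inU_F_mul_K

theorem AdNil.Kinv_mul {r : UR k} (h : AdNil k r) : AdNil k (inU k (Kinv k) * r) :=
  h.skew_mul inU_F_mul_Kinv

theorem AdNil.E_mul {r : UR k} (h : AdNil k r) : AdNil k (inU k (E k) * r) := by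
  induction h with
  | zero => simpa using AdNil.zero
  | step c r hr ih =>
    refine AdNil.step c _ ?_
    have hFE : inU k (F k) * inU k (E k) = inU k (E k) * inU k (F k)
        - (v k - (v k)⁻¹)⁻¹ • (inU k (K k) - inU k (Kinv k)) := by
      rw [← map_mul, ← map_mul, ← map_sub, ← map_smul, ← map_sub, ← E_mul_F_sub, sub_sub_cancel]
    have hr' : AdNil k r := AdNil.step c r hr
    have h1 : inU k (F k) * (inU k (E k) * r) - c • (inU k (E k) * r * inU k (F k))
        = inU k (E k) * (inU k (F k) * r - c • (r * inU k (F k)))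
          + ((algebraMap (RatFunc k) (R k) (-(v k - (v k)⁻¹)⁻¹)) • (inU k (K k) * r)
          + (algebraMap (RatFunc k) (R k) ((v k - (v k)⁻¹)⁻¹)) • (inU k (Kinv k) * r)) := by
      rw [algebraMap_smul, algebraMap_smul, ← mul_assoc, hFE, sub_mul, smul_mul_assoc, sub_mul,
        mul_sub, mul_smul_comm, neg_smul, smul_sub, mul_assoc, mul_assoc]
      abel
    rw [h1]
    exact ih.add ((hr'.K_mul.smul _).add (hr'.Kinv_mul.smul _))

theorem AdNil.one : AdNil k 1 := by
  refine AdNil.step 1 _ ?_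
  simpa using AdNil.zero

theorem AdNil.inU_mul (u : U k) {r : UR k} (h : AdNil k r) : AdNil k (inU k u * r) := by
  obtain ⟨x, rfl⟩ := mkU_surjective k u
  induction x using FreeAlgebra.induction generalizing r with
  | grade0 c =>
    rw [AlgHom.commutes, AlgHom.commutes, ← Algebra.smul_def, ← algebraMap_smul (R k)]
    exact h.smul _
  | grade1 g =>
    cases g with
    | E => exact h.E_mul
    | F => exact h.F_mul
    | K => exact h.K_mul
    | Kinv => exact h.Kinv_mul
  | mul a b ha hb =>
    rw [map_mul, map_mul, mul_assoc]
    exact ha (hb h)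
  | add a b ha hb =>
    rw [map_add, map_add, add_mul]
    exact (ha h).add (hb h)

theorem adNil (r : UR k) : AdNil k r := by
  induction r using TensorProduct.induction_on with
  | zero => exact AdNil.zero
  | tmul a u =>
    have : a ⊗ₜ[RatFunc k] u = a • (inU k u * 1 : UR k) := by
      simp [TensorProduct.smul_tmul']
    rw [this]
    exact (AdNil.one.inU_mul u).smul a
  | add x y hx hy => exact hx.add hy

theorem exists_F_pow_mul_eq (r : UR k) (n : ℕ) :
    ∃ (N : ℕ) (r' : UR k), inU k (F k) ^ N * r = r' * inU k (F k) ^ n := by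
  have h := adNil r
  induction h generalizing n with
  | zero => exact ⟨0, 0, by simp⟩
  | step c r _ ih =>
    induction n with
    | zero => exact ⟨0, r, by simp⟩
    | succ n ihn =>
      obtain ⟨N, x, hx⟩ := ihn
      obtain ⟨N', y, hy⟩ := ih (n + 1)
      refine ⟨N + N' + 1, inU k (F k) ^ N * y + c • (inU k (F k) ^ N' * x), ?_⟩
      have h1 : inU k (F k) * r
          = (inU k (F k) * r - c • (r * inU k (F k))) + c • (r * inU k (F k)) := by abel
      have h2 : inU k (F k) ^ (N + N') * (r * inU k (F k))
          = inU k (F k) ^ N' * (x * inU k (F k) ^ (n + 1)) := by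
        rw [add_comm N N', pow_add, mul_assoc, ← mul_assoc _ r, hx, mul_assoc, ← pow_succ]
      rw [pow_succ, mul_assoc, h1, mul_add, mul_smul_comm, h2, pow_add, mul_assoc, hy, add_mul,
        smul_mul_assoc, mul_assoc, mul_assoc]

theorem exists_F_pow_mul_eq_zero (r : UR k) (n : ℕ) (h0 : r * inU k (F k) ^ n = 0) :
    ∃ N : ℕ, inU k (F k) ^ N * r = 0 := by
  have key : ∀ r : UR k, r * inU k (F k) = 0 → ∃ N : ℕ, inU k (F k) ^ N * r = 0 := by
    intro r hr
    have h := adNil r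
    induction h with
    | zero => exact ⟨0, by simp⟩
    | step c r _ ih =>
      rw [hr, smul_zero, sub_zero] at ih
      obtain ⟨N, hN⟩ := ih (by rw [mul_assoc, hr, mul_zero])
      exact ⟨N + 1, by rw [pow_succ, mul_assoc, hN]⟩
  induction n generalizing r with
  | zero => exact ⟨0, by simpa using h0⟩
  | succ n ih =>
    rw [pow_succ, ← mul_assoc] at h0
    obtain ⟨N, hN⟩ := key _ h0
    rw [← mul_assoc] at hN
    obtain ⟨N', hN'⟩ := ih _ hN
    exact ⟨N' + N, by rw [pow_add, mul_assoc, hN']⟩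

theorem nonempty_oreSet : Nonempty (OreLocalization.OreSet (FPow k)) := by
  rw [OreLocalization.nonempty_oreSet_iff]
  constructor
  · rintro r₁ r₂ ⟨_, n, rfl⟩ h
    obtain ⟨N, hN⟩ := exists_F_pow_mul_eq_zero (r₁ - r₂) n (by
      rw [sub_mul]
      exact sub_eq_zero.mpr h)
    refine ⟨⟨_, N, rfl⟩, ?_⟩
    rw [mul_sub] at hN
    exact sub_eq_zero.mp hN
  · rintro r ⟨_, n, rfl⟩
    obtain ⟨N, r', h⟩ := exists_F_pow_mul_eq r n
    exact ⟨r', ⟨_, N, rfl⟩, h⟩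

/-- The powers of `F` form a left Ore set in `_R U`. -/
instance : OreLocalization.OreSet (FPow k) := Classical.choice nonempty_oreSet

variable (k) (A : Type u) [AddCommGroup A] [Module (UR k) A]

/-- The localization `A_F` of a `_R U`-module `A` with respect to the powers of `F`. -/
abbrev LocF : Type u := OreLocalization (FPow k) A

variable {A} in
/-- The element `F⁻ⁿ a` of `A_F`. -/
def FInvPow (n : ℕ) (a : A) : LocF k A := a /ₒ ⟨inU k (F k) ^ n, n, rfl⟩

/-- The canonical map `ι : A → A_F`. -/
def iota : A →ₗ[UR k] LocF k A where
  toFun a := a /ₒ 1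
  map_add' a b := OreLocalization.add_oreDiv.symm
  map_smul' r a := by
    rw [RingHom.id_apply, ← OreLocalization.smul_one_oreDiv_one_smul, OreLocalization.smul_div_one]
    simp

/-- `A_π = A_F / ι A`. -/
abbrev Pi : Type u := LocF k A ⧸ LinearMap.range (iota k A)

/-- `F` acts locally nilpotently on `A`. -/
def FLocallyNilpotent : Prop := ∀ a : A, ∃ n : ℕ, inU k (F k) ^ n • a = 0

theorem fLocallyNilpotent_Pi : FLocallyNilpotent k (Pi k A) := by
  intro x
  obtain ⟨y, rfl⟩ := Submodule.Quotient.mk_surjective _ x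
  induction y using OreLocalization.ind with
  | _ a t =>
    obtain ⟨_, n, rfl⟩ := t
    refine ⟨n, ?_⟩
    rw [← Submodule.Quotient.mk_smul, Submodule.Quotient.mk_eq_zero]
    refine ⟨a, ?_⟩
    rw [← OreLocalization.smul_one_oreDiv_one_smul, smul_eq_mul, mul_one]
    exact (OreLocalization.smul_cancel (S := FPow k) (t := 1)
      (s := ⟨inU k (F k) ^ n, n, rfl⟩)).symm

end Localization

/-! ## Invariant forms -/

section QuotientForm

variable {S 𝒜 X Y : Type*} [CommRing S] [Ring 𝒜] [Algebra S 𝒜]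
  [AddCommGroup X] [Module 𝒜 X] [Module S X] [IsScalarTower S 𝒜 X]
  [AddCommGroup Y] [Module 𝒜 Y] [Module S Y] [IsScalarTower S 𝒜 Y]

/-- The bilinear form on quotients induced by a bilinear form. -/
def quotientForm (p : Submodule 𝒜 X) (q : Submodule 𝒜 Y) (χ : X →ₗ[S] Y →ₗ[S] S)
    (hl : ∀ x ∈ p, ∀ y, χ x y = 0) (hr : ∀ x, ∀ y ∈ q, χ x y = 0) :
    (X ⧸ p) →ₗ[S] (Y ⧸ q) →ₗ[S] S :=
  LinearMap.mk₂ S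
    (Quotient.lift₂ (fun x y => χ x y) (by
      intro x y x' y' h h'
      replace h := (Submodule.quotientRel_def p).mp h
      replace h' := (Submodule.quotientRel_def q).mp h'
      have h1 : χ x y - χ x' y = 0 := by simpa using hl _ h y
      have h2 : χ x' y - χ x' y' = 0 := by simpa using hr x' _ h'
      exact (sub_eq_zero.mp h1).trans (sub_eq_zero.mp h2)))
    (by rintro ⟨x⟩ ⟨x'⟩ ⟨y⟩; exact LinearMap.map_add₂ χ x x' y)
    (by rintro c ⟨x⟩ ⟨y⟩; exact LinearMap.map_smul₂ χ c x y)
    (by rintro ⟨x⟩ ⟨y⟩ ⟨y'⟩; exact map_add (χ x) y y')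
    (by rintro c ⟨x⟩ ⟨y⟩; exact map_smul (χ x) c y)

theorem quotientForm_mk (p : Submodule 𝒜 X) (q : Submodule 𝒜 Y) (χ : X →ₗ[S] Y →ₗ[S] S)
    (hl : ∀ x ∈ p, ∀ y, χ x y = 0) (hr : ∀ x, ∀ y ∈ q, χ x y = 0) (x : X) (y : Y) :
    quotientForm p q χ hl hr (Submodule.Quotient.mk x) (Submodule.Quotient.mk y) = χ x y := rfl

end QuotientForm

section Forms

set_option linter.unusedSectionVars false

variable {k : Type u} [Field k]
variable {A B : Type u}
  [AddCommGroup A] [Module (UR k) A] [Module (R k) A] [IsScalarTower (R k) (UR k) A]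
  [AddCommGroup B] [Module (UR k) B] [Module (R k) B] [IsScalarTower (R k) (UR k) B]

/-- An `R`-valued pairing is `ϱ`-invariant if `φ(u a, b) = φ(a, ϱ(u) b)` for `u ∈ U`. -/
def IsInvariant (φ : A →ₗ[R k] B →ₗ[R k] R k) : Prop :=
  ∀ (u : U k) (a : A) (b : B), φ (inU k u • a) b = φ a (inU k (rho k u).unop • b)

/-- A form on `A_F × B_F` that vanishes on `ι A × B_F` and on `A_F × ι B` induces a form on
`A_π × B_π`. -/
def piForm (χ : LocF k A →ₗ[R k] LocF k B →ₗ[R k] R k)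
    (hl : ∀ a y, χ (iota k A a) y = 0) (hr : ∀ x b, χ x (iota k B b) = 0) :
    Pi k A →ₗ[R k] Pi k B →ₗ[R k] R k :=
  quotientForm (LinearMap.range (iota k A)) (LinearMap.range (iota k B)) χ
    (by rintro _ ⟨a, rfl⟩ y; exact hl a y) (by rintro x _ ⟨b, rfl⟩; exact hr x b)

theorem piForm_mk (χ : LocF k A →ₗ[R k] LocF k B →ₗ[R k] R k)
    (hl : ∀ a y, χ (iota k A a) y = 0) (hr : ∀ x b, χ x (iota k B b) = 0)
    (x : LocF k A) (y : LocF k B) :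
    piForm χ hl hr (Submodule.Quotient.mk x) (Submodule.Quotient.mk y) = χ x y :=
  quotientForm_mk _ _ χ _ _ x y

/-- A pairing of `A` and `B` as a linear map `A ⊗ B^{ρ₁} → R`. -/
def formTensor (φ : A →ₗ[R k] B →ₗ[R k] R k) :
    A ⊗[R k] Twist (rho1R k : UR k →+* UR k) B →ₗ[R k] R k :=
  TensorProduct.lift (φ.compl₂ (toTwistRho1 B).symm.toLinearMap)

theorem formTensor_tmul (φ : A →ₗ[R k] B →ₗ[R k] R k) (a : A) (b : B) :
    formTensor φ (a ⊗ₜ toTwistRho1 B b) = φ a b := by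
  simp [formTensor]

/-! ## Lusztig's map `L` -/

/-- The `n`-th term `(-1)ⁿ v^{-n(n-1)/2} {n} F⁽ⁿ⁾ a ⊗ E⁽ⁿ⁾ b` of `L(a ⊗ b)`. -/
def LTerm (n : ℕ) (a : A) (b : B) : A ⊗[R k] B :=
  algebraMap (RatFunc k) (R k) ((-1) ^ n * v k ^ (-((n : ℤ) * (n - 1) / 2)) * qBrace k n) •
    ((inU k (divPow k (F k) n) • a) ⊗ₜ[R k] (inU k (divPow k (E k) n) • b))

theorem LTerm_finite (hA : FLocallyNilpotent k A) (a : A) (b : B) :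
    (Function.support fun n => LTerm (k := k) n a b).Finite := by
  obtain ⟨N, hN⟩ := hA a
  refine (Set.finite_Iio N).subset fun n hn => ?_
  by_contra h
  rw [Set.mem_Iio, not_lt] at h
  apply hn
  have h0 : inU k (divPow k (F k) n) • a = 0 := by
    obtain ⟨m, rfl⟩ := Nat.exists_eq_add_of_le' h
    rw [divPow, map_smul, map_pow, ← algebraMap_smul (R k), smul_assoc, pow_add, mul_smul, hN,
      smul_zero, smul_zero]
  simp only [LTerm, h0, TensorProduct.zero_tmul, smul_zero]

/-- `L(a ⊗ b) = ∑ₙ (-1)ⁿ v^{-n(n-1)/2} {n} F⁽ⁿ⁾ a ⊗ E⁽ⁿ⁾ b`, a finite sum for each `a` and `b` since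
`F` acts locally nilpotently on `A`. -/
def L (hA : FLocallyNilpotent k A) : A ⊗[R k] B →ₗ[R k] A ⊗[R k] B :=
  TensorProduct.lift (LinearMap.mk₂ (R k) (fun a b => ∑ᶠ n : ℕ, LTerm (k := k) n a b)
    (fun a a' b => by
      rw [← finsum_add_distrib (LTerm_finite hA a b) (LTerm_finite hA a' b)]
      refine finsum_congr fun n => ?_
      rw [LTerm, smul_add, TensorProduct.add_tmul, smul_add, LTerm, LTerm])
    (fun c a b => by
      rw [smul_finsum' c (LTerm_finite hA a b)]
      refine finsum_congr fun n => ?_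
      rw [LTerm, smul_comm _ c a, ← TensorProduct.smul_tmul', smul_comm, LTerm])
    (fun a b b' => by
      rw [← finsum_add_distrib (LTerm_finite hA a b) (LTerm_finite hA a b')]
      refine finsum_congr fun n => ?_
      rw [LTerm, smul_add, TensorProduct.tmul_add, smul_add, LTerm, LTerm])
    (fun c a b => by
      rw [smul_finsum' c (LTerm_finite hA a b)]
      refine finsum_congr fun n => ?_
      rw [LTerm, smul_comm _ c b, TensorProduct.tmul_smul, smul_comm, LTerm]))

theorem L_tmul (hA : FLocallyNilpotent k A) (a : A) (b : B) :
    L hA (a ⊗ₜ[R k] b) = ∑ᶠ n : ℕ, LTerm (k := k) n a b := by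
  simp [L]

end Forms

/-! ## The Verma module, its Shapovalov form, the lifted form and the cycle -/

section Verma

variable (k : Type u) [Field k]

/-- The left ideal of `_R U` generated by `E` and `K - T vⁿ`. -/
def vermaIdeal (n : ℤ) : Submodule (UR k) (UR k) :=
  Submodule.span (UR k) {inU k (E k), inU k (K k) - algebraMap (R k) (UR k) (v k ^ n • T k)}

/-- The Verma module of highest weight `T vⁿ`, i.e. the module induced from the character `E ↦ 0`,
`K ↦ T vⁿ` of the subalgebra generated by `R`, `E` and `K^{±1}`. -/
abbrev Verma (n : ℤ) : Type u := UR k ⧸ vermaIdeal k n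

/-- The Verma module `M` of highest weight `T v⁻¹`. -/
abbrev M : Type u := Verma k (-1)

/-- `a` is killed by `E` and has weight `T vⁿ`. -/
structure IsSingular {A : Type u} [AddCommGroup A] [Module (UR k) A]
    (n : ℤ) (a : A) : Prop where
  E_smul : inU k (E k) • a = 0
  K_smul : inU k (K k) • a = algebraMap (R k) (UR k) (v k ^ n • T k) • a

variable {k}

/-- `w` is a highest weight vector of `M`: singular of weight `T v⁻¹`, and a generator of `M`. -/
structure IsHighestWeightVector (w : M k) : Prop where
  singular : IsSingular k (-1) w
  generates : Submodule.span (UR k) {w} = ⊤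

/-- The Shapovalov form of `M`: the `ϱ`-invariant form with `φ(w, w) = 1`. -/
structure IsShapovalovForm (w : M k) (φ : M k →ₗ[R k] M k →ₗ[R k] R k) : Prop where
  invariant : IsInvariant φ
  normalized : φ w w = 1

/-- `φ_F` is the lift to `M_F` of a form `φ` on `M`. All singular vectors of `M` have weight
`T v⁻¹`, for which the normalizing factor of the lift is `1`. -/
structure IsLift (φ : M k →ₗ[R k] M k →ₗ[R k] R k)
    (φF : LocF k (M k) →ₗ[R k] LocF k (M k) →ₗ[R k] R k) : Prop where
  invariant : IsInvariant φF
  vanish_left : ∀ a y, φF (iota k (M k) a) y = 0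
  vanish_right : ∀ x b, φF x (iota k (M k) b) = 0
  lift : ∀ a b : M k, IsSingular k (-1) a → IsSingular k (-1) b →
    φF (FInvPow k 1 a) (FInvPow k 1 b) = φ a b

/-- The form `φ_π` on `M_π` induced by the lift. -/
def IsLift.formPi {φ : M k →ₗ[R k] M k →ₗ[R k] R k}
    {φF : LocF k (M k) →ₗ[R k] LocF k (M k) →ₗ[R k] R k} (h : IsLift φ φF) :
    Pi k (M k) →ₗ[R k] Pi k (M k) →ₗ[R k] R k :=
  piForm φF h.vanish_left h.vanish_right

variable (k) in
/-- A nondegenerate cycle for `A`: an isomorphism of `_R U`-modules `(A_π)^{sT'₋₁} ≃ A`. -/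
abbrev NondegenerateCycle (A : Type u) [AddCommGroup A] [Module (UR k) A] : Type u :=
  Twist (sTprime k : UR k →+* UR k) (Pi k A) ≃ₗ[UR k] A

/-- With `m` the class of `F⁻¹ w` in `M_π`, the formula
`Ψ(F⁻ʲ m) = (-1)ʲ v^{-j²} Tʲ / ([j]! [T;-1]_{(j)}) Fʲ w` for `j ≥ 0`. -/
def IsVermaCycle (w : M k) (Ψ : NondegenerateCycle k (M k)) : Prop :=
  ∀ j : ℕ, Ψ (toTwist _ _ (Submodule.Quotient.mk (FInvPow k (j + 1) w))) =
    ((((-1) ^ j * v k ^ (-(j : ℤ) ^ 2) * (qFact k j)⁻¹) • T k ^ j * (qTFalling k (-1) j)⁻¹ : R k)) •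
      (inU k (F k) ^ j • w)

/-- The form `φ^♯` on `M`, determined by `φ^♯(Ψ(a), Ψ(b)) = s(φ_π(L(a ⊗ b)))`; here `L` is taken on
`M_π ⊗ M_π^{ρ₁}`. -/
def sharp (Ψ : NondegenerateCycle k (M k)) (φπ : Pi k (M k) →ₗ[R k] Pi k (M k) →ₗ[R k] R k)
    (x y : M k) : R k :=
  s k (formTensor φπ (L (fLocallyNilpotent_Pi k (M k))
    ((toTwist _ _).symm (Ψ.symm x) ⊗ₜ toTwistRho1 _ ((toTwist _ _).symm (Ψ.symm y)))))

end Verma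

end QSL2

end

/-!
The Verma module `M` has the `R`-basis `Fⁿ w`, `n ≥ 0`, its localization `M_F` the `R`-basis `Fⁿ w`,
`n ∈ ℤ`, and `M_π` the `R`-basis `F⁻ʲ m`, `j ≥ 0`. All three are weight bases, with `E` acting by
`E Fⁿ w = [n][T; -n] Fⁿ⁻¹ w` for every integer `n`. Linear independence in `M` comes from a model of
`M_F`, the free `R`-module on `ℤ` with these formulas (`modelU`, `linearIndependent_F_pow_w₀`); it
passes to `M_F` because a power of `F` moves any finite set of these vectors into `M`
(`linearIndependent_of_F_pow`). Any highest weight vector is a unit multiple of the canonical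
generator, because the weights `T v^{-1-2n}` are distinct (`IsHighestWeightVector.exists_unit`).

An invariant form is diagonal in a weight basis, and its diagonal entries obey
`c n = v^{2n} T⁻¹ [n][T; -n] c (n - 1)`; conversely this recursion implies invariance
(`isInvariant_diagForm_nat`, `isInvariant_diagForm_int`). On `M` the entry at `n = 0` determines all
others. On `M_F` the ratio vanishes exactly at `n = 0`, so that the entries at `n ≥ 0` may be zero,
and it is a unit of `R` at the other integers, so that the entry at `n = -1` determines those at
`n < 0`. This gives existence and uniqueness of the Shapovalov form and of its lift.

For the twisted action, `m` is singular of weight `T v⁻¹`. The resulting homomorphism from `M` to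
the twist of `M_π` maps `Fʲ w` to a unit multiple of `F⁻ʲ m`, hence is bijective, and `Ψ` is its
inverse (`existsUnique_isVermaCycle`).

Since `ρ₁` maps `E` to `-v F`, the form `φ_π ∘ L` is diagonal in the basis `F⁻ʲ m` too. Its
comparison with `φ ∘ (Ψ ⊗ Ψ)` therefore amounts to one scalar identity for each `j`
(`sum_lCoeff_mul_gramPi`), in which the left side is, up to a common factor, a terminating
`q`-Chu–Vandermonde sum (`sum_qTerm`).
-/

noncomputable section

namespace QSL2

set_option linter.unusedSectionVars false

/-! ### Scalars -/

section Scalars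

variable (k : Type u) [Field k]

theorem v_zpow_ne_one {n : ℤ} (hn : n ≠ 0) : v k ^ n ≠ 1 := by
  have hpos : ∀ m : ℕ, m ≠ 0 → v k ^ m ≠ 1 := by
    intro m hm h
    have h' : algebraMap (Polynomial k) (RatFunc k) (Polynomial.X ^ m) = algebraMap _ _ 1 := by
      simpa [RatFunc.algebraMap_X] using h
    have := congrArg Polynomial.natDegree (RatFunc.algebraMap_injective k h')
    simp [hm] at this
  obtain ⟨m, rfl | rfl⟩ := n.eq_nat_or_neg
  · simpa using hpos m (by simpa using hn)
  · simpa using hpos m (by simpa using hn)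

theorem v_zpow_ne_zpow_neg {n : ℤ} (hn : n ≠ 0) : v k ^ n ≠ v k ^ (-n) := by
  intro h
  refine v_zpow_ne_one k (n := n + n) (by omega) ?_
  rw [zpow_add₀ (v_ne_zero k)]
  nth_rewrite 2 [h]
  rw [← zpow_add₀ (v_ne_zero k), add_neg_cancel, zpow_zero]

theorem v_sub_inv_ne_zero : v k - (v k)⁻¹ ≠ 0 := by
  have := v_zpow_ne_zpow_neg k (n := 1) one_ne_zero
  simpa [sub_eq_zero] using this

theorem qInt_ne_zero {n : ℤ} (hn : n ≠ 0) : qInt k n ≠ 0 :=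
  div_ne_zero (sub_ne_zero.mpr (v_zpow_ne_zpow_neg k hn)) (v_sub_inv_ne_zero k)

theorem qFact_succ (n : ℕ) : qFact k (n + 1) = qFact k n * qInt k (n + 1) :=
  Finset.prod_range_succ _ _

theorem isUnit_iff_constantCoeff {f : R k} : IsUnit f ↔ PowerSeries.constantCoeff f ≠ 0 := by
  rw [PowerSeries.isUnit_iff_constantCoeff, isUnit_iff_ne_zero]

theorem T_mul_Tinv : T k * (T k)⁻¹ = 1 := PowerSeries.mul_inv_cancel _ (by simp [T])

theorem isUnit_T : IsUnit (T k) := IsUnit.of_mul_eq_one _ (T_mul_Tinv k)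

theorem constantCoeff_qT (r : ℤ) : PowerSeries.constantCoeff (qT k r) = qInt k r := by
  rw [qT, qInt, ← PowerSeries.coeff_zero_eq_constantCoeff_apply]
  simp [T, div_eq_inv_mul]

theorem isUnit_qT {r : ℤ} (hr : r ≠ 0) : IsUnit (qT k r) := by
  rw [isUnit_iff_constantCoeff, constantCoeff_qT]
  exact qInt_ne_zero k hr

theorem isUnit_algebraMap {c : RatFunc k} (hc : c ≠ 0) : IsUnit (algebraMap (RatFunc k) (R k) c) :=
  (isUnit_iff_ne_zero.mpr hc).map _

/-- The weight `T v^{-1-2n}` of `Fⁿ w`. -/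
def wt (n : ℤ) : R k := v k ^ (-1 - 2 * n) • T k

/-- The inverse of `wt n`. -/
def wtInv (n : ℤ) : R k := v k ^ (1 + 2 * n) • (T k)⁻¹

/-- The scalar `[n][T; -n]` with `E Fⁿ w = [n][T; -n] Fⁿ⁻¹ w`. -/
def eCoeff (n : ℤ) : R k := qInt k n • qT k (-n)

/-- The ratio `v^{2n} T⁻¹ [n][T; -n]` of the values of an invariant form at the vectors of weights
`wt n` and `wt (n - 1)`. -/
def gramStep (n : ℤ) : R k := v k ^ (2 * n) • ((T k)⁻¹ * eCoeff k n)

/-- The embedding of `R` in its field of fractions, where scalar identities are verified. -/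
abbrev toFrac : R k →+* FractionRing (R k) := algebraMap _ _

theorem toFrac_injective : Function.Injective (toFrac k) := IsFractionRing.injective _ _

theorem toFrac_smul (c : RatFunc k) (f : R k) :
    toFrac k (c • f) = (toFrac k).comp (algebraMap (RatFunc k) (R k)) c * toFrac k f := by
  rw [Algebra.smul_def, map_mul]; rfl

theorem toFrac_inv {f : R k} (hf : IsUnit f) : toFrac k f⁻¹ = (toFrac k f)⁻¹ := by
  refine eq_inv_of_mul_eq_one_left ?_
  rw [← map_mul, PowerSeries.inv_mul_cancel _ ((isUnit_iff_constantCoeff k).mp hf), map_one]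

theorem toFrac_ne_zero {f : R k} (hf : f ≠ 0) : toFrac k f ≠ 0 := by
  simpa using hf

/-- The embedding of `k(v)` in the field of fractions of `R`. -/
abbrev scalarF : RatFunc k →+* FractionRing (R k) := (toFrac k).comp (algebraMap (RatFunc k) (R k))

theorem toFrac_algebraMap (c : RatFunc k) :
    toFrac k (algebraMap (RatFunc k) (R k) c) = scalarF k c := rfl

theorem scalarF_ne_zero {c : RatFunc k} (hc : c ≠ 0) : scalarF k c ≠ 0 := by
  simpa using hc

theorem eCoeff_zero : eCoeff k 0 = 0 := by simp [eCoeff, qInt]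

theorem isUnit_eCoeff {n : ℤ} (hn : n ≠ 0) : IsUnit (eCoeff k n) := by
  rw [eCoeff, Algebra.smul_def]
  exact (isUnit_algebraMap k (qInt_ne_zero k hn)).mul (isUnit_qT k (neg_ne_zero.mpr hn))

theorem gramStep_zero : gramStep k 0 = 0 := by simp [gramStep, eCoeff_zero]

theorem isUnit_gramStep {n : ℤ} (hn : n ≠ 0) : IsUnit (gramStep k n) := by
  rw [gramStep, Algebra.smul_def]
  refine (isUnit_algebraMap k (zpow_ne_zero _ (v_ne_zero k))).mul
    (IsUnit.mul (IsUnit.of_mul_eq_one _ ((mul_comm _ _).trans (T_mul_Tinv k))) (isUnit_eCoeff k hn))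

theorem wt_mul_wtInv (n : ℤ) : wt k n * wtInv k n = 1 := by
  rw [wt, wtInv, smul_mul_smul_comm, T_mul_Tinv, ← zpow_add₀ (v_ne_zero k)]
  simp

theorem wtInv_mul_wt (n : ℤ) : wtInv k n * wt k n = 1 := by rw [mul_comm, wt_mul_wtInv]

theorem wt_succ (n : ℤ) : wt k (n + 1) = (v k ^ 2)⁻¹ • wt k n := by
  rw [wt, wt, smul_smul, ← zpow_natCast, ← zpow_neg, ← zpow_add₀ (v_ne_zero k)]
  congr 2; push_cast; ring

theorem wt_injective {m n : ℤ} (h : m ≠ n) : wt k m - wt k n ≠ 0 := by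
  rw [wt, wt, ← sub_smul, Algebra.smul_def]
  refine mul_ne_zero ((isUnit_algebraMap k ?_).ne_zero) (isUnit_T k).ne_zero
  rw [sub_ne_zero]
  intro h'
  refine v_zpow_ne_one k (n := (-1 - 2 * m) - (-1 - 2 * n)) (by omega) ?_
  rw [zpow_sub₀ (v_ne_zero k), h', div_self (zpow_ne_zero _ (v_ne_zero k))]

theorem eCoeff_succ (n : ℤ) :
    eCoeff k (n + 1) = eCoeff k n + (v k - (v k)⁻¹)⁻¹ • (wt k n - wtInv k n) := by
  apply toFrac_injective
  have hd := scalarF_ne_zero k (v_sub_inv_ne_zero k)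
  have hv := scalarF_ne_zero k (v_ne_zero k)
  have hT := toFrac_ne_zero k (isUnit_T k).ne_zero
  simp only [eCoeff, qT, qInt, wt, wtInv, toFrac_smul, map_add, map_sub, toFrac_inv k (isUnit_T k),
    map_div₀, map_inv₀, map_zpow₀, neg_neg] at hd ⊢
  have h1 : ∀ a b : ℤ, scalarF k (v k) ^ (a + b) = scalarF k (v k) ^ a * scalarF k (v k) ^ b :=
    fun a b => zpow_add₀ hv a b
  simp only [neg_add, sub_eq_add_neg, two_mul, h1, zpow_neg, zpow_one] at hd ⊢
  have hn : scalarF k (v k) ^ n ≠ 0 := zpow_ne_zero _ hv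
  generalize scalarF k (v k) ^ n = x at *
  generalize scalarF k (v k) = y at *
  generalize toFrac k (T k) = t at *
  have hd' : y ^ 2 - 1 ≠ 0 := by
    intro h; apply hd; field_simp; linear_combination h
  field_simp
  ring

theorem gramStep_eq (n : ℤ) :
    gramStep k n = algebraMap (RatFunc k) (R k) (v k) * (eCoeff k n * wtInv k (n - 1)) := by
  rw [← Algebra.smul_def, gramStep, wtInv, mul_smul_comm, smul_smul, mul_comm (eCoeff k n),
    ← zpow_one_add₀ (v_ne_zero k)]
  congr 2; ring

theorem eCoeff_eq (n : ℤ) :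
    eCoeff k n = algebraMap (RatFunc k) (R k) (v k) * (wt k n * gramStep k n) := by
  have h := T_mul_Tinv k
  rw [← Algebra.smul_def, gramStep, wt, smul_mul_smul_comm, smul_smul, ← mul_assoc (T k), h, one_mul,
    ← zpow_add₀ (v_ne_zero k), ← zpow_one_add₀ (v_ne_zero k)]
  ring_nf
  simp

/-- `s` is an involution: composed with itself it is the substitution of `T - 1` for `T - 1`. -/
theorem s_s (f : R k) : s k (s k f) = f := by
  have hX : s k PowerSeries.X = (T k)⁻¹ - 1 := by
    rw [s, PowerSeries.coe_substAlgHom]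
    exact PowerSeries.subst_X (hasSubst_Tinv k)
  have hXX : s k (s k PowerSeries.X) = PowerSeries.X := by
    have h1 : s k (T k)⁻¹ = T k := by
      have h2 : s k (T k) * s k (T k)⁻¹ = 1 := by rw [← map_mul, T_mul_Tinv, map_one]
      rw [s_T] at h2
      calc s k (T k)⁻¹ = (T k * (T k)⁻¹) * s k (T k)⁻¹ := by rw [T_mul_Tinv, one_mul]
        _ = T k := by rw [mul_assoc, h2, mul_one]
    rw [hX, map_sub, h1, map_one, T, add_sub_cancel_left]
  have hs : ∀ g, s k g = PowerSeries.subst ((T k)⁻¹ - 1 : R k) g := fun g => by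
    rw [s, PowerSeries.coe_substAlgHom]
  rw [hs (s k f), hs f, PowerSeries.subst_comp_subst_apply (hasSubst_Tinv k) (hasSubst_Tinv k),
    ← hs, ← hX, hXX, PowerSeries.X_subst]

theorem s_bijective : Function.Bijective (s k) :=
  (Function.Involutive.bijective (s_s k))

theorem s_Tinv : s k (T k)⁻¹ = T k := by rw [← s_T, s_s]

end Scalars

/-! ### A terminating `q`-Chu–Vandermonde sum -/

section QIdentity

variable {L : Type*} [Field L]

/-- `yⁿ - y⁻ⁿ`. -/
def brace (y : L) (n : ℕ) : L := y ^ n - (y ^ n)⁻¹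

/-- `∏_{a=1}^n (yᵃ - y⁻ᵃ)`. -/
def braceFact (y : L) (n : ℕ) : L := ∏ i ∈ Finset.range n, brace y (i + 1)

theorem braceFact_succ (y : L) (n : ℕ) : braceFact y (n + 1) = braceFact y n * brace y (n + 1) :=
  Finset.prod_range_succ _ _

/-- `yⁿ x - y⁻ⁿ`. -/
def braceAt (y x : L) (n : ℕ) : L := y ^ n * x - (y ^ n)⁻¹

/-- The `(n, m)` term of the sum in `sum_qTerm`. -/
def qTerm (y : L) (a g : ℕ → L) (x : L) (n m : ℕ) : L :=
  a n * g m * x ^ m * (∏ i ∈ Finset.range n, braceAt y x (m + 1 + i)) /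
    (braceFact y n * braceFact y m)

theorem brace_add {y : L} (hy : y ≠ 0) (n m : ℕ) :
    brace y (n + m) = y ^ n * brace y m + (y ^ m)⁻¹ * brace y n := by
  simp only [brace, pow_add]
  field_simp
  ring

variable {y : L} {a g : ℕ → L}

theorem qTerm_succ_right (hy : y ≠ 0) (hb : ∀ n, 0 < n → brace y n ≠ 0)
    (hg : ∀ m, g (m + 1) = g m * y ^ (2 * m + 2)) (x : L) (n m : ℕ) :
    y ^ n * brace y (m + 1) * qTerm y a g x n (m + 1) = x * y ^ 2 * qTerm y a g (y ^ 2 * x) n m := by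
  have hB : braceFact y n ≠ 0 := Finset.prod_ne_zero_iff.mpr fun i _ => hb _ (by omega)
  have hB' : braceFact y m ≠ 0 := Finset.prod_ne_zero_iff.mpr fun i _ => hb _ (by omega)
  have hm := hb (m + 1) (by omega)
  have hP : ∏ i ∈ Finset.range n, braceAt y (y ^ 2 * x) (m + 1 + i)
      = y ^ n * ∏ i ∈ Finset.range n, braceAt y x (m + 1 + 1 + i) := by
    rw [← Finset.card_range n, ← Finset.prod_const, Finset.card_range, ← Finset.prod_mul_distrib]
    refine Finset.prod_congr rfl fun i _ => ?_
    have h : m + 1 + 1 + i = m + 1 + i + 1 := by omega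
    rw [braceAt, braceAt, h, pow_succ y (m + 1 + i)]
    field_simp
  rw [qTerm, qTerm, hP, braceFact_succ, hg]
  field_simp
  ring

theorem qTerm_succ_left (hy : y ≠ 0) (hb : ∀ n, 0 < n → brace y n ≠ 0)
    (ha : ∀ n, a (n + 1) = -(a n * y * (y ^ n)⁻¹)) (x : L) (n m : ℕ) :
    (y ^ m)⁻¹ * brace y (n + 1) * qTerm y a g x (n + 1) m
      = -(braceAt y x (n + m + 1) * y * (y ^ (n + m))⁻¹) * qTerm y a g x n m := by
  have hB : braceFact y n ≠ 0 := Finset.prod_ne_zero_iff.mpr fun i _ => hb _ (by omega)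
  have hB' : braceFact y m ≠ 0 := Finset.prod_ne_zero_iff.mpr fun i _ => hb _ (by omega)
  have hm := hb (n + 1) (by omega)
  have h : m + 1 + n = n + m + 1 := by omega
  rw [qTerm, qTerm, braceFact_succ, ha, Finset.prod_range_succ, pow_add y n m, h]
  generalize braceAt y x (n + m + 1) = z
  field_simp

/-- A terminating `q`-Chu–Vandermonde sum: the left side does not depend on `x`. The addition rule
for `yʲ⁺¹ - y⁻ʲ⁻¹` expresses the sum for `j + 1` at `x` through the sums for `j` at `y² x` and
at `x`. -/
theorem sum_qTerm (hy : y ≠ 0) (hb : ∀ n, 0 < n → brace y n ≠ 0)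
    (ha0 : a 0 = 1) (ha : ∀ n, a (n + 1) = -(a n * y * (y ^ n)⁻¹))
    (hg0 : g 0 = 1) (hg : ∀ m, g (m + 1) = g m * y ^ (2 * m + 2))
    {r : ℕ → L} (hr0 : r 0 = 1) (hr : ∀ j, r (j + 1) = r j * (y ^ (2 * j))⁻¹) (j : ℕ) (x : L) :
    ∑ p ∈ Finset.HasAntidiagonal.antidiagonal j, qTerm y a g x p.1 p.2 = r j / braceFact y j := by
  induction j generalizing x with
  | zero => simp [qTerm, ha0, hg0, hr0, braceFact]
  | succ j ih =>
    have hj := hb (j + 1) (by omega)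
    have hB : braceFact y j ≠ 0 := Finset.prod_ne_zero_iff.mpr fun i _ => hb _ (by omega)
    have h0 : brace y 0 = 0 := by simp [brace]
    have key : brace y (j + 1) * ∑ p ∈ Finset.HasAntidiagonal.antidiagonal (j + 1), qTerm y a g x p.1 p.2
        = x * y ^ 2 * ∑ p ∈ Finset.HasAntidiagonal.antidiagonal j, qTerm y a g (y ^ 2 * x) p.1 p.2
          + -(braceAt y x (j + 1) * y * (y ^ j)⁻¹)
            * ∑ p ∈ Finset.HasAntidiagonal.antidiagonal j, qTerm y a g x p.1 p.2 := by
      have h1 : brace y (j + 1) * ∑ p ∈ Finset.HasAntidiagonal.antidiagonal (j + 1), qTerm y a g x p.1 p.2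
          = ∑ p ∈ Finset.HasAntidiagonal.antidiagonal (j + 1), y ^ p.1 * brace y p.2 * qTerm y a g x p.1 p.2
            + ∑ p ∈ Finset.HasAntidiagonal.antidiagonal (j + 1),
                (y ^ p.2)⁻¹ * brace y p.1 * qTerm y a g x p.1 p.2 := by
        rw [Finset.mul_sum, ← Finset.sum_add_distrib]
        refine Finset.sum_congr rfl fun p hp => ?_
        rw [← Finset.HasAntidiagonal.mem_antidiagonal.mp hp, brace_add hy, add_mul]
      rw [h1, Finset.Nat.sum_antidiagonal_succ', Finset.Nat.sum_antidiagonal_succ]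
      simp only [h0, mul_zero, zero_mul, zero_add]
      rw [Finset.mul_sum, Finset.mul_sum]
      congr 1
      · exact Finset.sum_congr rfl fun p _ => qTerm_succ_right hy hb hg x _ _
      · refine Finset.sum_congr rfl fun p hp => ?_
        rw [qTerm_succ_left hy hb ha, Finset.HasAntidiagonal.mem_antidiagonal.mp hp]
    rw [ih, ih] at key
    refine mul_left_cancel₀ hj (key.trans ?_)
    rw [braceFact_succ, hr, braceAt]
    field_simp
    ring

end QIdentity

/-! ### Strings of weight vectors -/

section Modules

variable {k : Type u} [Field k]
variable {A : Type u} [AddCommGroup A] [Module (UR k) A]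

theorem pow_succ_smul (x : UR k) (n : ℕ) (a : A) : x ^ (n + 1) • a = x • x ^ n • a := by
  rw [pow_succ', mul_smul]

theorem pow_smul_smul (x : UR k) (n : ℕ) (a : A) : x ^ n • x • a = x ^ (n + 1) • a := by
  rw [pow_succ, mul_smul]

theorem Kinv_K_smul (a : A) : inU k (Kinv k) • inU k (K k) • a = a := by
  rw [← mul_smul, ← map_mul, Kinv_mul_K, map_one, one_smul]

variable [Module (R k) A] [IsScalarTower (R k) (UR k) A]

theorem inU_smul_smul (c : RatFunc k) (u : U k) (a : A) :
    inU k (c • u) • a = algebraMap (RatFunc k) (R k) c • inU k u • a := by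
  rw [map_smul, ← algebraMap_smul (R k) c (inU k u), smul_assoc]

theorem inU_algebraMap_smul (c : RatFunc k) (a : A) :
    inU k (algebraMap (RatFunc k) (U k) c) • a = algebraMap (RatFunc k) (R k) c • a := by
  rw [Algebra.algebraMap_eq_smul_one, inU_smul_smul, map_one, one_smul]

theorem inU_smul_comm (u : U k) (r : R k) (a : A) : inU k u • r • a = r • inU k u • a :=
  smul_comm _ _ _

theorem E_F_smul (a : A) : inU k (E k) • inU k (F k) • a = inU k (F k) • inU k (E k) • a
    + algebraMap (RatFunc k) (R k) (v k - (v k)⁻¹)⁻¹ • (inU k (K k) • a - inU k (Kinv k) • a) := by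
  rw [← sub_smul, ← map_sub, ← inU_smul_smul, ← E_mul_F_sub, map_sub, sub_smul, map_mul, map_mul,
    mul_smul, mul_smul]
  abel

theorem K_F_smul (a : A) : inU k (K k) • inU k (F k) • a
    = algebraMap (RatFunc k) (R k) (v k ^ 2)⁻¹ • inU k (F k) • inU k (K k) • a := by
  rw [← mul_smul, ← map_mul, K_mul_F, inU_smul_smul, map_mul, mul_smul]

/-- `K` acts on `a` by the weight `T v^{-1-2n}`. -/
def HasWt (n : ℤ) (a : A) : Prop := inU k (K k) • a = wt k n • a

theorem HasWt.Kinv_smul {n : ℤ} {a : A} (h : HasWt (k := k) n a) :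
    inU k (Kinv k) • a = wtInv k n • a := by
  have h1 := congrArg (fun x => wtInv k n • inU k (Kinv k) • x) h
  simp only [Kinv_K_smul] at h1
  rw [h1, inU_smul_comm, smul_smul, wtInv_mul_wt, one_smul]

theorem HasWt.F_smul {n : ℤ} {a : A} (h : HasWt (k := k) n a) :
    HasWt (k := k) (n + 1) (inU k (F k) • a) := by
  rw [HasWt, K_F_smul, h, inU_smul_comm, smul_smul, wt_succ, Algebra.smul_def]

/-- One step of the computation of the action of `E` along an `F`-string. -/
theorem E_F_smul_of_hasWt {n : ℤ} {a : A} (h : HasWt (k := k) n a)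
    {b : A} (hb : inU k (F k) • b = a) (hE : inU k (E k) • a = eCoeff k n • b) :
    inU k (E k) • inU k (F k) • a = eCoeff k (n + 1) • a := by
  rw [E_F_smul, hE, inU_smul_comm, hb, h, h.Kinv_smul, ← sub_smul, smul_smul, ← add_smul, eCoeff_succ,
    Algebra.smul_def]

theorem hasWt_zero_iff {a : A} : HasWt (k := k) 0 a ↔
    inU k (K k) • a = algebraMap (R k) (UR k) (v k ^ (-1 : ℤ) • T k) • a := by
  rw [HasWt, wt, algebraMap_smul]; simp

theorem IsSingular.hasWt {w : A} (h : IsSingular k (-1) w) : HasWt (k := k) 0 w :=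
  hasWt_zero_iff.mpr h.K_smul

theorem IsSingular.hasWt_pow {w : A} (h : IsSingular k (-1) w) (n : ℕ) :
    HasWt (k := k) n (inU k (F k) ^ n • w) := by
  induction n with
  | zero => simpa using h.hasWt
  | succ n ih =>
    rw [pow_succ', mul_smul]
    exact_mod_cast ih.F_smul

theorem IsSingular.E_pow_succ {w : A} (h : IsSingular k (-1) w) (n : ℕ) :
    inU k (E k) • inU k (F k) ^ (n + 1) • w = eCoeff k (n + 1) • inU k (F k) ^ n • w := by
  induction n with
  | zero =>
    have := h.hasWt
    simp only [zero_add, pow_one, pow_zero, one_smul, Nat.cast_zero]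
    rw [E_F_smul, h.E_smul, this, this.Kinv_smul, ← sub_smul, smul_smul, smul_zero, zero_add]
    have h1 := eCoeff_succ k 0
    rw [eCoeff_zero, zero_add, zero_add, Algebra.smul_def] at h1
    rw [h1]
  | succ n ih =>
    rw [pow_succ' _ (n + 1), mul_smul]
    have := E_F_smul_of_hasWt (h.hasWt_pow (n + 1)) (b := inU k (F k) ^ n • w)
      (by rw [pow_succ', mul_smul]) (by exact_mod_cast ih)
    exact_mod_cast this

theorem isSingular_smul {w : A} (h : IsSingular k (-1) w) (r : R k) :
    IsSingular k (-1) (r • w) where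
  E_smul := by rw [inU_smul_comm, h.E_smul, smul_zero]
  K_smul := by rw [inU_smul_comm, h.K_smul, smul_comm]

/-- An `R`-submodule that is stable under the generators of `U` is stable under `_R U`. -/
theorem smul_mem_of_gen (N : Submodule (R k) A)
    (hN : ∀ g, ∀ a ∈ N, inU k (gen k g) • a ∈ N) (x : UR k) {a : A} (ha : a ∈ N) : x • a ∈ N := by
  have hU : ∀ u : U k, ∀ a ∈ N, inU k u • a ∈ N := by
    intro u
    obtain ⟨x, rfl⟩ := mkU_surjective k u
    induction x using FreeAlgebra.induction with
    | grade0 c =>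
      intro a ha
      rw [AlgHom.commutes, inU_algebraMap_smul]
      exact N.smul_mem _ ha
    | grade1 g => exact hN g
    | mul x y hx hy =>
      intro a ha
      rw [map_mul, map_mul, mul_smul]
      exact hx _ (hy _ ha)
    | add x y hx hy =>
      intro a ha
      rw [map_add, map_add, add_smul]
      exact N.add_mem (hx _ ha) (hy _ ha)
  induction x using TensorProduct.induction_on with
  | zero => exact (zero_smul (UR k) a).symm ▸ N.zero_mem
  | tmul r u =>
    have : r ⊗ₜ[RatFunc k] u = r • inU k u := by simp [TensorProduct.smul_tmul']
    rw [this, smul_assoc]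
    exact N.smul_mem _ (hU u a ha)
  | add x y hx hy => rw [add_smul]; exact N.add_mem hx hy

/-- The vectors `Fⁿ w` span the module generated by a singular vector `w`, because their span is
stable under `E`, `F` and `K^{±1}`. -/
theorem IsSingular.span_F_pow {w : A} (h : IsSingular k (-1) w)
    (hw : Submodule.span (UR k) {w} = ⊤) :
    Submodule.span (R k) (Set.range fun n : ℕ => inU k (F k) ^ n • w) = ⊤ := by
  set N := Submodule.span (R k) (Set.range fun n : ℕ => inU k (F k) ^ n • w) with hN
  have hmem : ∀ n : ℕ, inU k (F k) ^ n • w ∈ N := fun n => Submodule.subset_span ⟨n, rfl⟩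
  have hgen : ∀ g, ∀ a ∈ N, inU k (gen k g) • a ∈ N := by
    intro g a ha
    induction ha using Submodule.span_induction with
    | zero => rw [smul_zero]; exact N.zero_mem
    | add x y _ _ hx hy => rw [smul_add]; exact N.add_mem hx hy
    | smul r x _ hx => rw [inU_smul_comm]; exact N.smul_mem _ hx
    | mem x hx =>
      obtain ⟨n, rfl⟩ := hx
      cases g with
      | E =>
        cases n with
        | zero =>
          simp only [pow_zero, one_smul]
          rw [h.E_smul]; exact N.zero_mem
        | succ n => simp only [h.E_pow_succ]; exact N.smul_mem _ (hmem n)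
      | F => simp only [← mul_smul, ← pow_succ']; exact hmem (n + 1)
      | K =>
        have := h.hasWt_pow n
        rw [HasWt] at this
        simp only [this]
        exact N.smul_mem _ (hmem n)
      | Kinv => simp only [(h.hasWt_pow n).Kinv_smul]; exact N.smul_mem _ (hmem n)
  rw [eq_top_iff]
  intro a _
  obtain ⟨x, rfl⟩ := Submodule.mem_span_singleton.mp (hw ▸ Submodule.mem_top : a ∈ Submodule.span (UR k) {w})
  exact smul_mem_of_gen N hgen x (by simpa using hmem 0)

/-- The vectors `b n` behave like `Fⁿ w`, `n ∈ ℤ`, for a singular vector `w` of weight `T v⁻¹`. -/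
structure IsFString (b : ℤ → A) : Prop where
  F_smul : ∀ n, inU k (F k) • b n = b (n + 1)
  hasWt : ∀ n, HasWt (k := k) n (b n)
  E_smul : ∀ n, inU k (E k) • b n = eCoeff k n • b (n - 1)

theorem hasWt_of_F_smul (hF : Function.Injective fun a : A => inU k (F k) • a) {n : ℤ} {a : A}
    (h : HasWt (k := k) (n + 1) (inU k (F k) • a)) : HasWt (k := k) n a := by
  apply hF
  simp only
  rw [HasWt, K_F_smul, wt_succ, Algebra.smul_def, mul_smul] at h
  have := (isUnit_algebraMap k (inv_ne_zero (pow_ne_zero 2 (v_ne_zero k)))).smul_left_cancel.mp h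
  rw [this, inU_smul_comm]

/-- Where `F` is injective, the weights and the action of `E` along a two-sided `F`-string are
determined by its vector at `0`, by induction in both directions. -/
theorem IsFString.of_isSingular (hF : Function.Injective fun a : A => inU k (F k) • a) {b : ℤ → A}
    (hb : ∀ n, inU k (F k) • b n = b (n + 1)) (h0 : IsSingular k (-1) (b 0)) :
    IsFString (k := k) b := by
  have hwt : ∀ n, HasWt (k := k) n (b n) := by
    intro n
    induction n using Int.induction_on with
    | zero => exact h0.hasWt
    | succ n ih => rw [← hb]; exact ih.F_smul
    | pred n ih =>
      apply hasWt_of_F_smul hF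
      rw [hb, sub_add_cancel]
      exact ih
  refine ⟨hb, hwt, fun n => ?_⟩
  induction n using Int.induction_on with
  | zero => rw [h0.E_smul, eCoeff_zero, zero_smul]
  | succ n ih =>
    rw [← hb, E_F_smul_of_hasWt (hwt n) (b := b (n - 1)) (by rw [hb, sub_add_cancel]) ih,
      add_sub_cancel_right]
  | pred n ih =>
    obtain ⟨m, hm⟩ : ∃ m : ℤ, m = -(n : ℤ) - 1 := ⟨_, rfl⟩
    have hm' : -(n : ℤ) = m + 1 := by omega
    rw [hm', add_sub_cancel_right] at ih
    rw [← hm]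
    have h := E_F_smul (k := k) (b m)
    apply hF
    simp only
    have h2 := hwt m
    rw [hb, ih, h2, h2.Kinv_smul, ← sub_smul, eCoeff_succ, add_smul, Algebra.smul_def,
      mul_smul] at h
    rw [← add_right_cancel h, inU_smul_comm, hb, sub_add_cancel]

theorem IsFString.F_pow_smul {b : ℤ → A} (hb : IsFString (k := k) b) (j : ℕ) (n : ℤ) :
    inU k (F k) ^ j • b n = b (n + j) := by
  induction j with
  | zero => simp
  | succ j ih => rw [pow_succ_smul, ih, hb.F_smul]; push_cast; rw [add_assoc]

section QuotientString

variable (b : Module.Basis ℤ (R k) A) (N : Submodule (UR k) A)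

/-- The vectors of negative index stay independent modulo a submodule without components there. -/
theorem linearIndependent_mk_negSucc (hN : ∀ x ∈ N, ∀ j, b.repr x (Int.negSucc j) = 0) :
    LinearIndependent (R k) fun j : ℕ => (Submodule.Quotient.mk (b (Int.negSucc j)) : A ⧸ N) := by
  rw [linearIndependent_iff']
  intro s g hg i hi
  have h1 : (Submodule.Quotient.mk (∑ j ∈ s, g j • b (Int.negSucc j)) : A ⧸ N) = 0 := by
    rw [← hg, ← Submodule.mkQ_apply, map_sum]
    rfl
  have h2 := hN _ ((Submodule.Quotient.mk_eq_zero _).mp h1) i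
  rw [map_sum, Finsupp.finsetSum_apply, Finset.sum_eq_single i] at h2
  · simpa using h2
  · intro j _ hj
    rw [map_smul b.repr, Module.Basis.repr_self, Finsupp.smul_apply,
      Finsupp.single_eq_of_ne (by simpa using hj.symm), smul_zero]
  · exact fun h => absurd hi h

theorem span_mk_negSucc (hN : ∀ n : ℕ, b n ∈ N) : Submodule.span (R k) (Set.range fun j : ℕ =>
    (Submodule.Quotient.mk (b (Int.negSucc j)) : A ⧸ N)) = ⊤ := by
  rw [eq_top_iff]
  rintro x -
  obtain ⟨y, rfl⟩ := Submodule.Quotient.mk_surjective _ x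
  induction b.mem_span y using Submodule.span_induction with
  | zero => exact Submodule.zero_mem _
  | add x y _ _ hx hy => exact Submodule.add_mem _ hx hy
  | smul r x _ hx => exact Submodule.smul_mem _ r hx
  | mem x hx =>
    obtain ⟨n, rfl⟩ := hx
    match n with
    | Int.ofNat n =>
      rw [Int.ofNat_eq_natCast, (Submodule.Quotient.mk_eq_zero N).mpr (hN n)]
      exact Submodule.zero_mem _
    | Int.negSucc n => exact Submodule.subset_span ⟨n, rfl⟩

theorem repr_negSucc_eq_zero {B : Type u} [AddCommGroup B] [Module (R k) B] {ι : Type*}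
    (c : Module.Basis ι (R k) B) (f : B →ₗ[R k] A) (hf : ∀ i, ∃ n : ℕ, f (c i) = b n) (x : B) (j : ℕ) :
    b.repr (f x) (Int.negSucc j) = 0 := by
  induction c.mem_span x using Submodule.span_induction with
  | zero => simp
  | add x y _ _ hx hy => rw [map_add, map_add, Finsupp.add_apply, hx, hy, add_zero]
  | smul r x _ hx =>
    rw [map_smul, map_smul b.repr r, Finsupp.smul_apply, hx, smul_zero]
  | mem x hx =>
    obtain ⟨i, rfl⟩ := hx
    obtain ⟨n, hn⟩ := hf i
    rw [hn, Module.Basis.repr_self, Finsupp.single_eq_of_ne (by omega)]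

/-- A two-sided `F`-string is linearly independent if its vectors at `n ≥ 0` are: a power of `F`
moves any finite part of the string there. -/
theorem linearIndependent_of_F_pow {b : ℤ → A} (hb : ∀ n, inU k (F k) • b n = b (n + 1))
    (h : LinearIndependent (R k) fun n : ℕ => b n) : LinearIndependent (R k) b := by
  have hpow : ∀ (j : ℕ) (n : ℤ), inU k (F k) ^ j • b n = b (n + j) := by
    intro j n
    induction j with
    | zero => simp
    | succ j ih => rw [pow_succ_smul, ih, hb]; push_cast; rw [add_assoc]
  rw [linearIndependent_iff_finset_linearIndependent]
  intro s
  obtain ⟨N, hN⟩ : ∃ N : ℕ, ∀ n ∈ s, -(N : ℤ) ≤ n := by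
    obtain ⟨b, hb⟩ := s.bddBelow
    exact ⟨b.natAbs, fun n hn => by have := hb hn; omega⟩
  refine LinearIndependent.of_comp (Algebra.lsmul (R k) (R k) A (inU k (F k) ^ N)) ?_
  have h' : (Algebra.lsmul (R k) (R k) A (inU k (F k) ^ N)) ∘ (b ∘ (Subtype.val : s → ℤ)) =
      (fun n : ℕ => b n) ∘ fun n : s => (n.1 + N).toNat := by
    funext n
    have hn := hN n.1 n.2
    simp only [Function.comp_apply, Algebra.lsmul_coe, hpow]
    rw [Int.toNat_of_nonneg (by omega)]
  rw [h']
  refine h.comp _ ?_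
  intro m n hmn
  have hm := hN m.1 m.2
  have hn := hN n.1 n.2
  simp only at hmn
  apply Subtype.ext
  omega

end QuotientString

end Modules

/-! ### The weight model -/

section Model

variable (k : Type u) [Field k]

/-- The free `R`-module on `eₙ`, `n ∈ ℤ`. -/
abbrev Model : Type u := ℤ →₀ R k

/-- The weighted shift `eₙ ↦ c n • e_{n+d}` of the model. -/
def shift (c : ℤ → R k) (d : ℤ) : Module.End (R k) (Model k) :=
  Finsupp.linearCombination (R k) fun n => Finsupp.single (n + d) (c n)

theorem shift_single (c : ℤ → R k) (d n : ℤ) (r : R k) :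
    shift k c d (Finsupp.single n r) = Finsupp.single (n + d) (r * c n) := by
  simp [shift]

theorem shift_mul (c c' : ℤ → R k) (d d' : ℤ) :
    shift k c d * shift k c' d' = shift k (fun n => c' n * c (n + d')) (d' + d) := by
  refine Finsupp.lhom_ext fun n r => ?_
  rw [Module.End.mul_apply, shift_single, shift_single, shift_single, mul_assoc, add_assoc]

theorem shift_sub (c c' : ℤ → R k) (d : ℤ) : shift k c d - shift k c' d = shift k (c - c') d := by
  refine Finsupp.lhom_ext fun n r => ?_
  simp [shift_single, mul_sub, Finsupp.single_sub]

theorem shift_smul (x : RatFunc k) (c : ℤ → R k) (d : ℤ) : x • shift k c d = shift k (x • c) d := by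
  refine Finsupp.lhom_ext fun n r => ?_
  simp only [LinearMap.smul_apply, shift_single, Finsupp.smul_single, Pi.smul_apply, mul_smul_comm]

theorem shift_one : shift k 1 0 = 1 := by
  refine Finsupp.lhom_ext fun n r => ?_
  simp [shift_single]

/-- The action of `U` on the model by `F eₙ = eₙ₊₁`, `K eₙ = T v^{-1-2n} eₙ`,
`E eₙ = [n][T; -n] eₙ₋₁`. -/
def modelU : U k →ₐ[RatFunc k] Module.End (R k) (Model k) :=
  liftU k (shift k (eCoeff k) (-1)) (shift k 1 1) (shift k (wt k) 0) (shift k (wtInv k) 0)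
    (by rw [shift_mul, ← shift_one]; congr 1; funext n; simp [wtInv_mul_wt])
    (by rw [shift_mul, ← shift_one]; congr 1; funext n; simp [wt_mul_wtInv])
    (by
      rw [shift_mul, shift_mul, shift_smul]; congr 1; funext n
      have h := wt_succ k (n - 1)
      have h' : v k ^ 2 • wt k n = wt k (n - 1) := by
        rw [sub_add_cancel] at h
        rw [h, smul_smul, mul_inv_cancel₀ (pow_ne_zero 2 (v_ne_zero k)), one_smul]
      simp only [add_zero, Pi.smul_apply, ← sub_eq_add_neg, ← h', mul_smul_comm]
      rw [mul_left_comm, wtInv_mul_wt, mul_one])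
    (by
      rw [shift_mul, shift_mul, shift_smul]; congr 1; funext n
      simp only [add_zero, Pi.smul_apply, Pi.one_apply, wt_succ, mul_smul_comm, one_mul]
      rw [wtInv_mul_wt])
    (by
      rw [shift_mul, shift_mul, add_neg_cancel, neg_add_cancel, shift_sub, shift_sub, shift_smul]
      congr 1; funext n
      simp [eCoeff_succ])

instance : Module (UR k) (Model k) :=
  Module.compHom (Model k)
    (Algebra.TensorProduct.lift (Algebra.ofId (R k) (Module.End (R k) (Model k))) (modelU k)
      fun r _ => Algebra.commutes r _ : UR k →ₐ[R k] Module.End (R k) (Model k)).toRingHom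

theorem smul_model (x : UR k) (f : Model k) : x • f =
    (Algebra.TensorProduct.lift (Algebra.ofId (R k) (Module.End (R k) (Model k))) (modelU k)
      fun r _ => Algebra.commutes r _ : UR k →ₐ[R k] Module.End (R k) (Model k)) x f := rfl

instance : IsScalarTower (R k) (UR k) (Model k) where
  smul_assoc r x f := by rw [smul_model, map_smul]; rfl

theorem inU_smul_model (u : U k) (f : Model k) : inU k u • f = modelU k u f := by
  rw [smul_model]
  refine (congrArg (fun g : Module.End (R k) (Model k) => g f)
    (Algebra.TensorProduct.lift_tmul _ _ _ 1 u)).trans ?_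
  rw [map_one, one_mul]

theorem F_smul_single (n : ℤ) (r : R k) :
    inU k (F k) • (Finsupp.single n r : Model k) = Finsupp.single (n + 1) r := by
  rw [inU_smul_model, modelU, liftU_gen, genVal, shift_single]; simp

theorem E_smul_single (n : ℤ) (r : R k) :
    inU k (E k) • (Finsupp.single n r : Model k) = Finsupp.single (n + -1) (r * eCoeff k n) := by
  rw [inU_smul_model, modelU, liftU_gen, genVal, shift_single]

theorem K_smul_single (n : ℤ) (r : R k) :
    inU k (K k) • (Finsupp.single n r : Model k) = Finsupp.single n (r * wt k n) := by
  rw [inU_smul_model, modelU, liftU_gen, genVal, shift_single, add_zero]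

theorem F_pow_smul_single (j : ℕ) (n : ℤ) (r : R k) :
    inU k (F k) ^ j • (Finsupp.single n r : Model k) = Finsupp.single (n + j) r := by
  induction j with
  | zero => simp
  | succ j ih => rw [pow_succ', mul_smul, ih, F_smul_single]; push_cast; rw [add_assoc]

theorem isSingular_single : IsSingular k (-1) (Finsupp.single 0 1 : Model k) where
  E_smul := by rw [E_smul_single, eCoeff_zero, mul_zero, Finsupp.single_zero]
  K_smul := by
    rw [K_smul_single, algebraMap_smul, Finsupp.smul_single, smul_eq_mul, mul_comm, wt]; simp

end Model

/-! ### The Verma module -/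

-- Shortcuts for instance search; each is the instance that would be found without them.
local instance {k : Type u} [Field k] : AddCommGroup (M k) := inferInstance

local instance {k : Type u} [Field k] : AddCommMonoid (M k) := inferInstance

local instance {k : Type u} [Field k] : Module (UR k) (M k) := inferInstance

local instance {k : Type u} [Field k] : Module (R k) (M k) := inferInstance

local instance {k : Type u} [Field k] : IsScalarTower (R k) (UR k) (M k) := inferInstance

local instance {k : Type u} [Field k] : AddCommGroup (LocF k (M k)) := inferInstance

local instance {k : Type u} [Field k] : AddCommMonoid (LocF k (M k)) := inferInstance

local instance {k : Type u} [Field k] : Module (UR k) (LocF k (M k)) := inferInstance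

local instance {k : Type u} [Field k] : Module (R k) (LocF k (M k)) := inferInstance

local instance {k : Type u} [Field k] : IsScalarTower (R k) (UR k) (LocF k (M k)) := inferInstance

local instance {k : Type u} [Field k] : AddCommGroup (Pi k (M k)) := inferInstance

local instance {k : Type u} [Field k] : AddCommMonoid (Pi k (M k)) := inferInstance

local instance {k : Type u} [Field k] : Module (UR k) (Pi k (M k)) := inferInstance

local instance {k : Type u} [Field k] : Module (R k) (Pi k (M k)) := inferInstance

local instance {k : Type u} [Field k] : IsScalarTower (R k) (UR k) (Pi k (M k)) := inferInstance

section Verma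

variable (k : Type u) [Field k]

/-- The canonical generator of the Verma module. -/
def w₀ : M k := Submodule.Quotient.mk 1

theorem mk_eq_smul_w₀ (x : UR k) : (Submodule.Quotient.mk x : M k) = x • w₀ k := by
  rw [w₀, ← Submodule.Quotient.mk_smul, smul_eq_mul, mul_one]

theorem isHighestWeightVector_w₀ : IsHighestWeightVector (w₀ k) where
  singular :=
    { E_smul := by
        rw [← mk_eq_smul_w₀, Submodule.Quotient.mk_eq_zero]
        exact Submodule.subset_span (Or.inl rfl)
      K_smul := by
        rw [← sub_eq_zero, ← sub_smul, ← mk_eq_smul_w₀, Submodule.Quotient.mk_eq_zero]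
        exact Submodule.subset_span (Or.inr rfl) }
  generates := by
    rw [eq_top_iff]
    rintro a -
    obtain ⟨x, rfl⟩ := Submodule.Quotient.mk_surjective _ a
    exact Submodule.mem_span_singleton.mpr ⟨x, (mk_eq_smul_w₀ k x).symm⟩

variable {k}
variable {A : Type u} [AddCommGroup A] [Module (UR k) A]

/-- The universal property of the Verma module for its canonical generator. -/
def vermaLift₀ {a : A} (ha : IsSingular k (-1) a) : M k →ₗ[UR k] A :=
  (vermaIdeal k (-1)).liftQ (LinearMap.toSpanSingleton (UR k) A a) (by
    rw [vermaIdeal, Submodule.span_le]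
    rintro x (rfl | rfl)
    · simpa using ha.E_smul
    · simpa [sub_smul, sub_eq_zero] using ha.K_smul)

theorem vermaLift₀_w₀ {a : A} (ha : IsSingular k (-1) a) : vermaLift₀ ha (w₀ k) = a := by
  rw [w₀, vermaLift₀]
  exact (Submodule.liftQ_apply _ _ _).trans (by simp)

variable (k) in
/-- The homomorphism to the model maps these vectors to basis vectors. -/
theorem linearIndependent_F_pow_w₀ :
    LinearIndependent (R k) fun n : ℕ => inU k (F k) ^ n • w₀ k := by
  refine LinearIndependent.of_comp ((vermaLift₀ (isSingular_single k)).restrictScalars (R k)) ?_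
  have h : ((vermaLift₀ (isSingular_single k)).restrictScalars (R k)) ∘
      (fun n : ℕ => inU k (F k) ^ n • w₀ k) = (fun n : ℤ => (Finsupp.single n 1 : Model k)) ∘
        (fun n : ℕ => (n : ℤ)) := by
    funext n
    simp only [Function.comp_apply, LinearMap.coe_restrictScalars, map_smul, vermaLift₀_w₀,
      F_pow_smul_single, zero_add]
  rw [h]
  exact (Finsupp.basisSingleOne (R := R k) (ι := ℤ)).linearIndependent.comp _ Nat.cast_injective

variable (k) in
/-- The basis `Fⁿ w₀` of the Verma module. -/
def basis₀ : Module.Basis ℕ (R k) (M k) :=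
  Module.Basis.mk (linearIndependent_F_pow_w₀ k)
    ((isHighestWeightVector_w₀ k).singular.span_F_pow (isHighestWeightVector_w₀ k).generates).ge

theorem basis₀_apply (n : ℕ) : basis₀ k n = inU k (F k) ^ n • w₀ k := by simp [basis₀]

/-- The vectors of weight `T v⁻¹` are the multiples of the canonical generator, since the weights
`T v^{-1-2n}` are distinct. -/
theorem exists_eq_smul_w₀ {a : M k} (ha : HasWt (k := k) 0 a) : ∃ c : R k, a = c • w₀ k := by
  refine ⟨(basis₀ k).repr a 0, ?_⟩
  have key : ∀ n : ℕ, n ≠ 0 → (basis₀ k).repr a n = 0 := by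
    -- `K` acts diagonally in the basis.
    have h : ∀ x : M k, ∀ n, (basis₀ k).repr (inU k (K k) • x) n = wt k n * (basis₀ k).repr x n := by
      intro x n
      induction (basis₀ k).mem_span x using Submodule.span_induction with
      | zero => simp
      | add x y _ _ hx hy => simp only [smul_add, map_add, Finsupp.add_apply, hx, hy, mul_add]
      | smul r x _ hx =>
        rw [inU_smul_comm, map_smul (basis₀ k).repr r, map_smul (basis₀ k).repr r,
          Finsupp.smul_apply, Finsupp.smul_apply, hx,
          smul_eq_mul, smul_eq_mul, mul_left_comm]
      | mem x hx =>
        obtain ⟨m, rfl⟩ := hx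
        have hm := (isHighestWeightVector_w₀ k).singular.hasWt_pow m
        rw [HasWt, ← basis₀_apply] at hm
        rw [hm, map_smul, Module.Basis.repr_self, Finsupp.smul_apply, smul_eq_mul]
        by_cases hmn : m = n
        · rw [hmn]
        · rw [Finsupp.single_eq_of_ne (Ne.symm hmn), mul_zero, mul_zero]
    intro n hn
    have h1 := h a n
    rw [ha, map_smul, Finsupp.smul_apply, smul_eq_mul, ← sub_eq_zero, ← sub_mul] at h1
    exact (mul_eq_zero.mp h1).resolve_left (wt_injective k (by exact_mod_cast hn.symm))
  apply (basis₀ k).repr.injective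
  ext n
  have h0 : w₀ k = basis₀ k 0 := by rw [basis₀_apply, pow_zero, one_smul]
  rw [map_smul, Finsupp.smul_apply, h0, Module.Basis.repr_self, smul_eq_mul]
  by_cases hn : n = 0
  · subst hn; simp
  · rw [key n hn, Finsupp.single_eq_of_ne hn, mul_zero]

/-- A highest weight vector is a unit multiple of the canonical generator. -/
theorem IsHighestWeightVector.exists_unit {w : M k} (hw : IsHighestWeightVector w) :
    ∃ c : (R k)ˣ, w = c • w₀ k := by
  obtain ⟨c, hc⟩ := exists_eq_smul_w₀ hw.singular.hasWt
  have h0 : w₀ k = basis₀ k 0 := by rw [basis₀_apply, pow_zero, one_smul]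
  -- All coefficients at the canonical generator are divisible by `c`, and one of them is `1`.
  have h : ∀ x : M k, c ∣ (basis₀ k).repr x 0 := by
    intro x
    induction (hw.singular.span_F_pow hw.generates ▸ Submodule.mem_top :
      x ∈ Submodule.span (R k) (Set.range fun n : ℕ => inU k (F k) ^ n • w))
      using Submodule.span_induction with
    | zero => simp
    | add x y _ _ hx hy => rw [map_add, Finsupp.add_apply]; exact dvd_add hx hy
    | smul r x _ hx => rw [map_smul, Finsupp.smul_apply]; exact hx.mul_left r
    | mem x hx =>
      obtain ⟨n, rfl⟩ := hx
      simp only [hc]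
      rw [smul_comm, map_smul, Finsupp.smul_apply]
      exact dvd_mul_right _ _
  have h1 := h (w₀ k)
  rw [h0, Module.Basis.repr_self, Finsupp.single_eq_same] at h1
  exact ⟨(isUnit_of_dvd_one h1).unit, hc⟩

theorem IsHighestWeightVector.exists_eq_smul {w : M k} (hw : IsHighestWeightVector w) {a : M k} (ha : HasWt (k := k) 0 a) :
    ∃ c : R k, a = c • w := by
  obtain ⟨c, rfl⟩ := exists_eq_smul_w₀ ha
  obtain ⟨d, rfl⟩ := hw.exists_unit
  refine ⟨c * (d⁻¹ : (R k)ˣ), ?_⟩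
  rw [Units.smul_def, smul_smul, mul_assoc, Units.inv_mul, mul_one]

theorem IsHighestWeightVector.linearIndependent {w : M k} (hw : IsHighestWeightVector w) :
    LinearIndependent (R k) fun n : ℕ => inU k (F k) ^ n • w := by
  obtain ⟨c, rfl⟩ := hw.exists_unit
  have := (linearIndependent_F_pow_w₀ k).units_smul fun _ => c
  convert this using 2 with n
  rw [Pi.smul_apply', Units.smul_def, Units.smul_def, smul_comm]

/-- The basis `Fⁿ w` of the Verma module. -/
def IsHighestWeightVector.basis {w : M k} (hw : IsHighestWeightVector w) :
    Module.Basis ℕ (R k) (M k) :=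
  Module.Basis.mk hw.linearIndependent (hw.singular.span_F_pow hw.generates).ge

theorem IsHighestWeightVector.basis_apply {w : M k} (hw : IsHighestWeightVector w) (n : ℕ) :
    hw.basis n = inU k (F k) ^ n • w := by simp [basis]

/-- The universal property of the Verma module. -/
theorem IsHighestWeightVector.exists_lift {w : M k} (hw : IsHighestWeightVector w)
    [Module (R k) A] [IsScalarTower (R k) (UR k) A] {a : A} (ha : IsSingular k (-1) a) :
    ∃ f : M k →ₗ[UR k] A, f w = a := by
  obtain ⟨c, rfl⟩ := hw.exists_unit
  refine ⟨vermaLift₀ (isSingular_smul ha ((c⁻¹ : (R k)ˣ) : R k)), ?_⟩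
  rw [Units.smul_def, LinearMap.map_smul_of_tower, vermaLift₀_w₀, smul_smul, Units.mul_inv,
    one_smul]

end Verma

/-! ### The localization of the Verma module -/

section Localized

variable {k : Type u} [Field k] {A : Type u} [AddCommGroup A] [Module (UR k) A]

theorem F_pow_smul_FInvPow (n : ℕ) (a : A) : inU k (F k) ^ n • FInvPow k n a = iota k A a := by
  rw [← OreLocalization.smul_one_oreDiv_one_smul, smul_eq_mul, mul_one]
  exact OreLocalization.smul_cancel (S := FPow k) (t := 1) (s := ⟨inU k (F k) ^ n, n, rfl⟩)

/-- A power of `F` acts on the localization as a unit of the localized ring. -/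
theorem F_pow_smul_injective (n : ℕ) :
    Function.Injective fun x : LocF k A => inU k (F k) ^ n • x := by
  intro x y h
  have h1 : ∀ z : LocF k A, ((1 : UR k) /ₒ (⟨inU k (F k) ^ n, n, rfl⟩ : FPow k)) •
      inU k (F k) ^ n • z = z := by
    intro z
    rw [← OreLocalization.smul_one_oreDiv_one_smul (inU k (F k) ^ n), ← mul_smul, smul_eq_mul,
      mul_one, OreLocalization.one_div_mul, one_mul]
    exact (congrArg (fun y => y • z) (OreLocalization.div_eq_one' (S := FPow k) ⟨n, rfl⟩)).trans (one_smul _ z)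
  rw [← h1 x, ← h1 y]
  exact congrArg _ h

theorem F_smul_injective : Function.Injective fun x : LocF k A => inU k (F k) • x := by
  simpa using F_pow_smul_injective (k := k) (A := A) 1

theorem F_smul_FInvPow_succ (n : ℕ) (a : A) :
    inU k (F k) • FInvPow k (n + 1) a = FInvPow k n a := by
  apply F_pow_smul_injective n
  simp only
  rw [pow_smul_smul, F_pow_smul_FInvPow, F_pow_smul_FInvPow]

theorem FInvPow_zero (a : A) : FInvPow k 0 a = iota k A a := by
  simpa using F_pow_smul_FInvPow (k := k) 0 a

theorem exists_eq_FInvPow (x : LocF k A) : ∃ n a, x = FInvPow k n a := by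
  induction x using OreLocalization.ind with
  | _ a t =>
    obtain ⟨_, n, rfl⟩ := t
    exact ⟨n, a, rfl⟩

theorem iota_injective (hF : Function.Injective fun a : A => inU k (F k) • a) :
    Function.Injective (iota k A) := by
  rw [injective_iff_map_eq_zero]
  intro a ha
  have h : a /ₒ (1 : FPow k) = (0 : A) /ₒ (1 : FPow k) :=
    ha.trans (OreLocalization.zero_oreDiv _).symm
  rw [OreLocalization.oreDiv_eq_iff] at h
  obtain ⟨⟨_, n, rfl⟩, r, h1, h2⟩ := h
  have h3 : inU k (F k) ^ n • a = 0 := by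
    have h4 : inU k (F k) ^ n = r := by simpa using h2
    rw [h4, ← h1, smul_zero]
  clear h1 h2
  induction n with
  | zero => simpa using h3
  | succ n ih =>
    apply ih
    apply hF
    simp only
    rw [smul_zero, ← mul_smul, ← pow_succ', h3]

theorem FInvPow_add (n : ℕ) (a b : A) : FInvPow k n (a + b) = FInvPow k n a + FInvPow k n b := by
  apply F_pow_smul_injective n
  simp only [smul_add, F_pow_smul_FInvPow, map_add]

/-- The vectors `Fⁿ w` of the localization, `n ∈ ℤ`. -/
def fVec (w : A) : ℤ → LocF k A
  | Int.ofNat n => iota k A (inU k (F k) ^ n • w)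
  | Int.negSucc n => FInvPow k (n + 1) w

theorem F_smul_fVec (w : A) (n : ℤ) : inU k (F k) • fVec (k := k) w n = fVec w (n + 1) := by
  match n with
  | Int.ofNat n =>
    change _ = iota k A (inU k (F k) ^ (n + 1) • w)
    rw [fVec, ← map_smul, ← mul_smul, pow_succ']
  | Int.negSucc 0 =>
    change _ = iota k A (inU k (F k) ^ 0 • w)
    rw [fVec, F_smul_FInvPow_succ, FInvPow_zero, pow_zero, one_smul]
  | Int.negSucc (n + 1) =>
    change _ = FInvPow k (n + 1) w
    rw [fVec, F_smul_FInvPow_succ]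

theorem F_pow_smul_fVec (w : A) (j : ℕ) (n : ℤ) :
    inU k (F k) ^ j • fVec (k := k) w n = fVec w (n + j) := by
  induction j with
  | zero => simp
  | succ j ih => rw [pow_succ_smul, ih, F_smul_fVec]; push_cast; rw [add_assoc]

theorem fVec_natCast (w : A) (n : ℕ) :
    fVec (k := k) w n = iota k A (inU k (F k) ^ n • w) := rfl

theorem FInvPow_F_pow (w : A) (n j : ℕ) :
    FInvPow k n (inU k (F k) ^ j • w) = fVec w (j - n : ℤ) := by
  apply F_pow_smul_injective n
  simp only
  rw [F_pow_smul_FInvPow, F_pow_smul_fVec, sub_add_cancel, fVec_natCast]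

variable [Module (R k) A] [IsScalarTower (R k) (UR k) A]

theorem iota_smul (r : R k) (a : A) : iota k A (r • a) = r • iota k A a :=
  LinearMap.map_smul_of_tower _ _ _

theorem FInvPow_smul (n : ℕ) (r : R k) (a : A) : FInvPow k n (r • a) = r • FInvPow k n a := by
  apply F_pow_smul_injective n
  simp only
  rw [F_pow_smul_FInvPow, ← map_pow, inU_smul_comm, map_pow, F_pow_smul_FInvPow, iota_smul]

theorem IsSingular.iota {w : A} (hw : IsSingular k (-1) w) : IsSingular k (-1) (iota k A w) where
  E_smul := by rw [← map_smul, hw.E_smul, map_zero]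
  K_smul := by rw [← map_smul, hw.K_smul, map_smul]

theorem fVec_zero (w : A) : fVec (k := k) w 0 = iota k A w := by
  have := fVec_natCast (k := k) w 0
  rwa [pow_zero, one_smul] at this

theorem IsSingular.isFString {w : A} (hw : IsSingular k (-1) w) :
    IsFString (k := k) (fVec (k := k) w) :=
  IsFString.of_isSingular F_smul_injective (F_smul_fVec w) (by rw [fVec_zero]; exact hw.iota)

end Localized

section LocalizedVerma

variable {k : Type u} [Field k] {w : M k}

namespace IsHighestWeightVector

theorem F_smul_injective (hw : IsHighestWeightVector w) :
    Function.Injective fun a : M k => inU k (F k) • a := by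
  let f : M k →ₗ[R k] M k := Algebra.lsmul (R k) (R k) (M k) (inU k (F k))
  have h : LinearIndependent (R k) (f ∘ hw.basis) := by
    have : f ∘ hw.basis = hw.basis ∘ Nat.succ := by
      funext n
      simp only [Function.comp_apply, hw.basis_apply, f, Algebra.lsmul_coe, pow_succ_smul]
    rw [this]
    exact hw.basis.linearIndependent.comp _ Nat.succ_injective
  have hker : LinearMap.ker f = ⊥ := by
    rw [LinearMap.ker_eq_bot']
    intro x hx
    rw [← hw.basis.linearCombination_repr x, Finsupp.apply_linearCombination] at hx
    have := (linearIndependent_iff.mp h) _ hx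
    simpa using this
  exact LinearMap.ker_eq_bot.mp hker

theorem linearIndependent_fVec (hw : IsHighestWeightVector w) :
    LinearIndependent (R k) (fVec (k := k) w) := by
  refine linearIndependent_of_F_pow (F_smul_fVec w) ?_
  have h : (fun n : ℕ => fVec (k := k) w n) = ((iota k (M k)).restrictScalars (R k)) ∘ hw.basis := by
    funext n
    rw [Function.comp_apply, hw.basis_apply]; rfl
  rw [h]
  exact hw.basis.linearIndependent.map' _
    (LinearMap.ker_eq_bot.mpr (iota_injective hw.F_smul_injective))

theorem span_fVec (hw : IsHighestWeightVector w) :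
    Submodule.span (R k) (Set.range (fVec (k := k) w)) = ⊤ := by
  rw [eq_top_iff]
  rintro x -
  obtain ⟨n, a, rfl⟩ := exists_eq_FInvPow x
  induction hw.basis.mem_span a using Submodule.span_induction with
  | zero =>
    have : FInvPow k n (0 : M k) = 0 := by simpa using FInvPow_smul (k := k) n 0 (0 : M k)
    rw [this]; exact Submodule.zero_mem _
  | add x y _ _ hx hy => rw [FInvPow_add]; exact Submodule.add_mem _ hx hy
  | smul r x _ hx => rw [FInvPow_smul]; exact Submodule.smul_mem _ _ hx
  | mem x hx =>
    obtain ⟨j, rfl⟩ := hx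
    rw [hw.basis_apply, FInvPow_F_pow]
    exact Submodule.subset_span ⟨_, rfl⟩

/-- The basis `Fⁿ w`, `n ∈ ℤ`, of the localized Verma module. -/
def basisLoc (hw : IsHighestWeightVector w) : Module.Basis ℤ (R k) (LocF k (M k)) :=
  Module.Basis.mk hw.linearIndependent_fVec hw.span_fVec.ge

theorem basisLoc_apply (hw : IsHighestWeightVector w) (n : ℤ) :
    hw.basisLoc n = fVec (k := k) w n := by simp [basisLoc]

/-- The basis `F⁻ʲ m` of `M_π`, where `m` is the class of `F⁻¹ w`. -/
def basisPi (hw : IsHighestWeightVector w) : Module.Basis ℕ (R k) (Pi k (M k)) :=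
  Module.Basis.mk
    (linearIndependent_mk_negSucc hw.basisLoc (LinearMap.range (iota k (M k))) (by
      rintro _ ⟨a, rfl⟩ j
      refine repr_negSucc_eq_zero hw.basisLoc hw.basis ((iota k (M k)).restrictScalars (R k))
        (fun n => ⟨n, ?_⟩) a j
      rw [hw.basisLoc_apply, hw.basis_apply]
      rfl))
    (span_mk_negSucc hw.basisLoc (LinearMap.range (iota k (M k))) (fun n => by
      rw [hw.basisLoc_apply]
      exact ⟨_, rfl⟩)).ge

theorem basisPi_eq_mk (hw : IsHighestWeightVector w) (j : ℕ) :
    hw.basisPi j = Submodule.Quotient.mk (fVec (k := k) w (Int.negSucc j)) := by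
  rw [basisPi, Module.Basis.mk_apply, basisLoc_apply]

theorem basisPi_apply (hw : IsHighestWeightVector w) (j : ℕ) :
    hw.basisPi j = Submodule.Quotient.mk (FInvPow k (j + 1) w) := hw.basisPi_eq_mk j

end IsHighestWeightVector

end LocalizedVerma

/-! ### Invariant forms -/

section Invariant

variable {k : Type u} [Field k]

theorem unop_rho_E : (rho k (E k)).unop = v k • (K k * F k) := by
  rw [rho, liftU_gen]; rfl

theorem unop_rho_F : (rho k (F k)).unop = v k • (Kinv k * E k) := by
  rw [rho, liftU_gen]; rfl

theorem unop_rho_K : (rho k (K k)).unop = K k := by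
  rw [rho, liftU_gen]; rfl

theorem unop_rho_Kinv : (rho k (Kinv k)).unop = Kinv k := by
  rw [rho, liftU_gen]; rfl

variable {A : Type u} [AddCommGroup A] [Module (UR k) A] [Module (R k) A]
  [IsScalarTower (R k) (UR k) A] {ι : Type*}

/-- Invariance may be checked for the generators of `U` on the vectors of a basis. -/
theorem isInvariant_of_basis (b : Module.Basis ι (R k) A) (φ : A →ₗ[R k] A →ₗ[R k] R k)
    (h : ∀ g i j, φ (inU k (gen k g) • b i) (b j) = φ (b i) (inU k (rho k (gen k g)).unop • b j)) :
    IsInvariant φ := by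
  intro u
  obtain ⟨x, rfl⟩ := mkU_surjective k u
  induction x using FreeAlgebra.induction with
  | grade0 c =>
    intro a b
    rw [AlgHom.commutes (mkU k), AlgHom.commutes (rho k), MulOpposite.algebraMap_apply, MulOpposite.unop_op,
      inU_algebraMap_smul, inU_algebraMap_smul, map_smul, map_smul, LinearMap.smul_apply]
  | grade1 g =>
    let l : U k → A →ₗ[R k] A := fun u => Algebra.lsmul (R k) (R k) A (inU k u)
    have : φ ∘ₗ l (gen k g) = φ.compl₂ (l (rho k (gen k g)).unop) := by
      refine LinearMap.ext_basis b b fun i j => ?_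
      exact h g i j
    intro a b
    exact LinearMap.congr_fun (LinearMap.congr_fun this a) b
  | mul x y hx hy =>
    intro a b
    rw [map_mul, map_mul, map_mul, MulOpposite.unop_mul, map_mul, mul_smul, mul_smul, hx, hy]
  | add x y hx hy =>
    intro a b
    rw [map_add, map_add, map_add, MulOpposite.unop_add, map_add, add_smul, add_smul, map_add,
      LinearMap.add_apply, map_add, hx, hy]

/-- The form with diagonal Gram matrix `c` in the basis `b`. -/
def diagForm (b : Module.Basis ι (R k) A) (c : ι → R k) : A →ₗ[R k] A →ₗ[R k] R k :=
  b.constr (R k) fun i => c i • b.coord i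

theorem diagForm_basis (b : Module.Basis ι (R k) A) (c : ι → R k) (i : ι) :
    diagForm b c (b i) = c i • b.coord i := by
  rw [diagForm, Module.Basis.constr_basis]

theorem diagForm_self (b : Module.Basis ι (R k) A) (c : ι → R k) (i : ι) :
    diagForm b c (b i) (b i) = c i := by
  rw [diagForm_basis, LinearMap.smul_apply, Module.Basis.coord_apply, Module.Basis.repr_self,
    Finsupp.single_eq_same, smul_eq_mul, mul_one]

theorem diagForm_of_ne (b : Module.Basis ι (R k) A) (c : ι → R k) {i j : ι} (h : i ≠ j) :
    diagForm b c (b i) (b j) = 0 := by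
  rw [diagForm_basis, LinearMap.smul_apply, Module.Basis.coord_apply, Module.Basis.repr_self,
    Finsupp.single_eq_of_ne h, smul_zero]

theorem eq_diagForm (b : Module.Basis ι (R k) A) (c : ι → R k) {φ : A →ₗ[R k] A →ₗ[R k] R k}
    (h : ∀ i, φ (b i) (b i) = c i) (h' : ∀ i j, i ≠ j → φ (b i) (b j) = 0) : φ = diagForm b c := by
  refine LinearMap.ext_basis b b fun i j => ?_
  by_cases hij : i = j
  · subst hij; rw [h, diagForm_self]
  · rw [h' i j hij, diagForm_of_ne b c hij]

theorem inU_rho_F_smul (a : A) : inU k (rho k (F k)).unop • a =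
    algebraMap (RatFunc k) (R k) (v k) • inU k (Kinv k) • inU k (E k) • a := by
  rw [unop_rho_F, inU_smul_smul, map_mul, mul_smul]

theorem inU_rho_E_smul (a : A) : inU k (rho k (E k)).unop • a =
    algebraMap (RatFunc k) (R k) (v k) • inU k (K k) • inU k (F k) • a := by
  rw [unop_rho_E, inU_smul_smul, map_mul, mul_smul]

/-- Since `K` acts diagonally, invariance of a diagonal form need only be checked for `E` and `F`. -/
theorem isInvariant_diagForm (b : Module.Basis ι (R k) A) (c : ι → R k) (μ : ι → ℤ)
    (hμ : ∀ i, HasWt (k := k) (μ i) (b i))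
    (hF : ∀ i j, diagForm b c (inU k (F k) • b i) (b j) =
      diagForm b c (b i) (inU k (rho k (F k)).unop • b j))
    (hE : ∀ i j, diagForm b c (inU k (E k) • b i) (b j) =
      diagForm b c (b i) (inU k (rho k (E k)).unop • b j)) :
    IsInvariant (diagForm b c) := by
  refine isInvariant_of_basis b _ fun g i j => ?_
  cases g with
  | E => exact hE i j
  | F => exact hF i j
  | K =>
    rw [unop_rho_K, hμ i, hμ j, map_smul, map_smul, LinearMap.smul_apply]
    by_cases h : i = j
    · rw [h]
    · rw [diagForm_of_ne b c h, smul_zero, smul_zero]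
  | Kinv =>
    rw [unop_rho_Kinv, (hμ i).Kinv_smul, (hμ j).Kinv_smul, map_smul, map_smul, LinearMap.smul_apply]
    by_cases h : i = j
    · rw [h]
    · rw [diagForm_of_ne b c h, smul_zero, smul_zero]

theorem isInvariant_diagForm_int (b : Module.Basis ℤ (R k) A) (hb : IsFString (k := k) b)
    (c : ℤ → R k) (hc : ∀ n, c (n + 1) = gramStep k (n + 1) * c n) :
    IsInvariant (diagForm b c) := by
  refine isInvariant_diagForm b c id hb.hasWt (fun i j => ?_) fun i j => ?_
  · rw [inU_rho_F_smul, hb.F_smul, hb.E_smul, inU_smul_comm, (hb.hasWt _).Kinv_smul, map_smul,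
      map_smul, map_smul]
    by_cases h : i + 1 = j
    · subst h
      rw [add_sub_cancel_right, diagForm_self, diagForm_self, hc, gramStep_eq, add_sub_cancel_right]
      simp only [smul_eq_mul, mul_assoc]
    · rw [diagForm_of_ne b c h, diagForm_of_ne b c (by omega), smul_zero, smul_zero, smul_zero]
  · rw [inU_rho_E_smul, hb.F_smul, hb.E_smul, hb.hasWt _, map_smul, map_smul, map_smul,
      LinearMap.smul_apply]
    by_cases h : i = j + 1
    · subst h
      rw [add_sub_cancel_right, diagForm_self, diagForm_self, hc, eCoeff_eq]
      simp only [smul_eq_mul, mul_assoc]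
    · rw [diagForm_of_ne b c h, diagForm_of_ne b c (by omega), smul_zero, smul_zero, smul_zero]

theorem isInvariant_diagForm_nat (b : Module.Basis ℕ (R k) A) {w : A} (hw : IsSingular k (-1) w)
    (hb : ∀ n, b n = inU k (F k) ^ n • w)
    (c : ℕ → R k) (hc : ∀ n : ℕ, c (n + 1) = gramStep k (n + 1) * c n) :
    IsInvariant (diagForm b c) := by
  have hwt : ∀ n : ℕ, HasWt (k := k) n (b n) := fun n => hb n ▸ hw.hasWt_pow n
  have hF : ∀ n, inU k (F k) • b n = b (n + 1) := fun n => by rw [hb, hb, pow_succ_smul]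
  have hE0 : inU k (E k) • b 0 = 0 := by rw [hb, pow_zero, one_smul, hw.E_smul]
  have hE : ∀ n : ℕ, inU k (E k) • b (n + 1) = eCoeff k (n + 1) • b n := fun n => by
    rw [hb, hb, hw.E_pow_succ]
  refine isInvariant_diagForm b c (fun n => n) hwt (fun i j => ?_) fun i j => ?_
  · rw [inU_rho_F_smul, hF]
    cases j with
    | zero => rw [hE0, smul_zero, smul_zero, LinearMap.map_zero, diagForm_of_ne b c (by omega)]
    | succ j =>
      rw [hE, inU_smul_comm, (hwt _).Kinv_smul, map_smul, map_smul, map_smul]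
      by_cases h : i = j
      · subst h
        rw [diagForm_self, diagForm_self, hc, gramStep_eq, add_sub_cancel_right]
        simp only [smul_eq_mul, mul_assoc]
      · rw [diagForm_of_ne b c (by omega), diagForm_of_ne b c h, smul_zero, smul_zero, smul_zero]
  · rw [inU_rho_E_smul, hF, hwt, LinearMap.map_smul, LinearMap.map_smul]
    cases i with
    | zero =>
      rw [hE0, map_zero, LinearMap.zero_apply, diagForm_of_ne b c (by omega), smul_zero, smul_zero]
    | succ i =>
      rw [hE, map_smul, LinearMap.smul_apply]
      by_cases h : i = j
      · subst h
        rw [diagForm_self, diagForm_self, hc, eCoeff_eq]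
        simp only [smul_eq_mul, mul_assoc, Nat.cast_add, Nat.cast_one]
      · rw [diagForm_of_ne b c h, diagForm_of_ne b c (by omega), smul_zero, smul_zero, smul_zero]

/-- Invariance under `K` makes weight spaces of distinct weights orthogonal. -/
theorem IsInvariant.eq_zero_of_hasWt {φ : A →ₗ[R k] A →ₗ[R k] R k} (hφ : IsInvariant φ) {m n : ℤ}
    {a b : A} (ha : HasWt (k := k) m a) (hb : HasWt (k := k) n b) (h : m ≠ n) : φ a b = 0 := by
  have h1 := hφ (K k) a b
  rw [unop_rho_K, ha, hb, map_smul, map_smul, LinearMap.smul_apply, smul_eq_mul, smul_eq_mul,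
    ← sub_eq_zero, ← sub_mul] at h1
  exact (mul_eq_zero.mp h1).resolve_left (wt_injective k h)

/-- Invariance under `F` determines the form along an `F`-string. -/
theorem IsInvariant.F_F {φ : A →ₗ[R k] A →ₗ[R k] R k} (hφ : IsInvariant φ) {n : ℤ} {a : A}
    (ha : HasWt (k := k) n a)
    (hE : inU k (E k) • inU k (F k) • a = eCoeff k (n + 1) • a) :
    φ (inU k (F k) • a) (inU k (F k) • a) = gramStep k (n + 1) * φ a a := by
  rw [hφ, inU_rho_F_smul, hE, inU_smul_comm, ha.Kinv_smul, map_smul, map_smul, map_smul,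
    gramStep_eq, add_sub_cancel_right]
  simp only [smul_eq_mul, mul_assoc]

end Invariant

/-! ### The Shapovalov form and its lift -/

section Shapovalov

variable (k : Type u) [Field k]

/-- The value of the Shapovalov form at `(Fⁿ w, Fⁿ w)`. -/
def gramM (n : ℕ) : R k := ∏ i ∈ Finset.range n, gramStep k (i + 1)

theorem gramM_succ (n : ℕ) : gramM k (n + 1) = gramStep k (n + 1) * gramM k n := by
  rw [gramM, Finset.prod_range_succ, mul_comm, gramM]

/-- The value of the lifted form at `(F⁻¹⁻ʲ w, F⁻¹⁻ʲ w)`. -/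
def gramPi (j : ℕ) : R k := ∏ i ∈ Finset.range j, (gramStep k (-(i + 1)))⁻¹

theorem mul_inv_gramStep {n : ℤ} (hn : n ≠ 0) : gramStep k n * (gramStep k n)⁻¹ = 1 :=
  PowerSeries.mul_inv_cancel _ ((isUnit_iff_constantCoeff k).mp (isUnit_gramStep k hn))

theorem gramStep_mul_gramPi (j : ℕ) : gramStep k (-(j + 1)) * gramPi k (j + 1) = gramPi k j := by
  rw [gramPi, Finset.prod_range_succ, mul_left_comm, mul_inv_gramStep k (by omega), mul_one, gramPi]

/-- The value of the lifted form at `(Fⁿ w, Fⁿ w)`, `n ∈ ℤ`; it is zero for `n ≥ 0`, where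
`Fⁿ w ∈ ι M`. -/
def gramLoc : ℤ → R k
  | Int.ofNat _ => 0
  | Int.negSucc j => gramPi k j

/-- The recursion of an invariant form holds at `n = -1` too, since `gramStep` vanishes at `0`. -/
theorem gramLoc_succ (n : ℤ) : gramLoc k (n + 1) = gramStep k (n + 1) * gramLoc k n := by
  match n with
  | Int.ofNat n => change 0 = _ * (0 : R k); rw [mul_zero]
  | Int.negSucc 0 =>
    have : Int.negSucc 0 + 1 = 0 := rfl
    rw [this, gramStep_zero, zero_mul]; rfl
  | Int.negSucc (j + 1) =>
    have : Int.negSucc (j + 1) + 1 = -(j + 1) := by rw [Int.negSucc_eq]; push_cast; ring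
    rw [this]
    exact (gramStep_mul_gramPi k j).symm

variable {k}

theorem IsShapovalovForm.eq_diagForm {w : M k} (hw : IsHighestWeightVector w)
    {φ : M k →ₗ[R k] M k →ₗ[R k] R k} (hφ : IsShapovalovForm w φ) :
    φ = diagForm hw.basis (gramM k) := by
  refine QSL2.eq_diagForm _ _ (fun i => ?_) fun i j hij => ?_
  · rw [hw.basis_apply]
    induction i with
    | zero => simpa [gramM] using hφ.normalized
    | succ n ih =>
      have hE := hw.singular.E_pow_succ n
      rw [pow_succ_smul] at hE ⊢
      rw [hφ.invariant.F_F (hw.singular.hasWt_pow n) hE, ih, gramM_succ]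
  · rw [hw.basis_apply, hw.basis_apply]
    exact hφ.invariant.eq_zero_of_hasWt (hw.singular.hasWt_pow i) (hw.singular.hasWt_pow j)
      (by exact_mod_cast hij)

theorem isShapovalovForm_diagForm {w : M k} (hw : IsHighestWeightVector w) :
    IsShapovalovForm w (diagForm hw.basis (gramM k)) where
  invariant := isInvariant_diagForm_nat _ hw.singular hw.basis_apply _ (gramM_succ k)
  normalized := by
    have h : w = hw.basis 0 := by rw [hw.basis_apply, pow_zero, one_smul]
    refine (congrArg₂ (fun a b => diagForm hw.basis (gramM k) a b) h h).trans ?_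
    rw [diagForm_self, gramM, Finset.prod_range_zero]

section Generic

variable {A : Type u} [AddCommGroup A] [Module (UR k) A] [Module (R k) A]
  [IsScalarTower (R k) (UR k) A]

/-- The entry at `n = -1` determines those at `n < -1`, where `gramStep` is a unit. -/
theorem IsInvariant.eq_diagForm_gramLoc {b : Module.Basis ℤ (R k) A} (hb : IsFString (k := k) b)
    {χ : A →ₗ[R k] A →ₗ[R k] R k} (hχ : IsInvariant χ) (h0 : ∀ n : ℕ, χ (b n) (b n) = 0)
    (h1 : χ (b (-1)) (b (-1)) = 1) : χ = diagForm b (gramLoc k) := by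
  refine eq_diagForm _ _ (fun n => ?_) fun i j hij => ?_
  · match n with
    | Int.ofNat n => exact h0 n
    | Int.negSucc j =>
      induction j with
      | zero => exact h1.trans (by simp [gramLoc, gramPi])
      | succ j ih =>
        obtain ⟨m, hm⟩ : ∃ m, m = Int.negSucc (j + 1) := ⟨_, rfl⟩
        have hm' : Int.negSucc j = m + 1 := by omega
        rw [← hm]
        rw [hm'] at ih
        have hE := hb.E_smul (m + 1)
        rw [← hb.F_smul, add_sub_cancel_right] at hE
        have h2 := hχ.F_F (hb.hasWt m) hE
        rw [hb.F_smul, ih, gramLoc_succ] at h2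
        exact (mul_left_cancel₀ (isUnit_gramStep k (by omega)).ne_zero h2).symm
  · exact hχ.eq_zero_of_hasWt (hb.hasWt i) (hb.hasWt j) hij

theorem diagForm_gramLoc_left (b : Module.Basis ℤ (R k) A) {B : Type u} [AddCommGroup B]
    [Module (R k) B] (c : Module.Basis ℕ (R k) B) (f : B →ₗ[R k] A) (hf : ∀ i, f (c i) = b i)
    (x : B) (y : A) : diagForm b (gramLoc k) (f x) y = 0 := by
  have : (diagForm b (gramLoc k)) ∘ₗ f = 0 := by
    refine c.ext fun i => ?_
    rw [LinearMap.comp_apply, hf, diagForm_basis]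
    exact zero_smul _ _
  exact LinearMap.congr_fun (LinearMap.congr_fun this x) y

theorem diagForm_gramLoc_right (b : Module.Basis ℤ (R k) A) {B : Type u} [AddCommGroup B]
    [Module (R k) B] (c : Module.Basis ℕ (R k) B) (f : B →ₗ[R k] A) (hf : ∀ i, f (c i) = b i)
    (x : A) (y : B) : diagForm b (gramLoc k) x (f y) = 0 := by
  have : (diagForm b (gramLoc k)).compl₂ f = 0 := by
    refine LinearMap.ext_basis b c fun i j => ?_
    rw [LinearMap.compl₂_apply, hf, LinearMap.zero_apply, LinearMap.zero_apply]
    by_cases h : i = j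
    · rw [h, diagForm_self]; rfl
    · exact diagForm_of_ne _ _ h
  exact LinearMap.congr_fun (LinearMap.congr_fun this x) y

end Generic

variable {w : M k}

theorem IsHighestWeightVector.isFString (hw : IsHighestWeightVector w) :
    IsFString (k := k) hw.basisLoc := by
  have h : ⇑hw.basisLoc = fVec (k := k) w := funext hw.basisLoc_apply
  rw [h]
  exact hw.singular.isFString

theorem IsHighestWeightVector.iota_basis (hw : IsHighestWeightVector w) (n : ℕ) :
    (iota k (M k)).restrictScalars (R k) (hw.basis n) = hw.basisLoc n := by
  rw [hw.basis_apply, hw.basisLoc_apply]; rfl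

theorem IsHighestWeightVector.FInvPow_one (hw : IsHighestWeightVector w) :
    FInvPow k 1 w = hw.basisLoc (-1) := by
  rw [hw.basisLoc_apply]; rfl

theorem IsLift.eq_diagForm (hw : IsHighestWeightVector w) {φ : M k →ₗ[R k] M k →ₗ[R k] R k}
    (hφ : IsShapovalovForm w φ) {φF : LocF k (M k) →ₗ[R k] LocF k (M k) →ₗ[R k] R k}
    (h : IsLift φ φF) : φF = diagForm hw.basisLoc (gramLoc k) := by
  refine IsInvariant.eq_diagForm_gramLoc hw.isFString h.invariant (fun n => ?_) ?_
  · rw [← hw.iota_basis]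
    exact h.vanish_left _ _
  · rw [← hw.FInvPow_one, h.lift w w hw.singular hw.singular, hφ.normalized]

theorem diagForm_iota_left (hw : IsHighestWeightVector w) (a : M k) (y : LocF k (M k)) :
    diagForm hw.basisLoc (gramLoc k) (iota k (M k) a) y = 0 :=
  diagForm_gramLoc_left hw.basisLoc hw.basis ((iota k (M k)).restrictScalars (R k)) hw.iota_basis a y

theorem diagForm_iota_right (hw : IsHighestWeightVector w) (x : LocF k (M k)) (b : M k) :
    diagForm hw.basisLoc (gramLoc k) x (iota k (M k) b) = 0 :=
  diagForm_gramLoc_right hw.basisLoc hw.basis ((iota k (M k)).restrictScalars (R k)) hw.iota_basis x b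

theorem diagForm_FInvPow (hw : IsHighestWeightVector w) (α β : R k) :
    diagForm hw.basisLoc (gramLoc k) (FInvPow k 1 (α • w)) (FInvPow k 1 (β • w)) = α • β • 1 := by
  have h : gramLoc k (-1) = 1 := by
    change gramPi k 0 = 1
    rw [gramPi, Finset.prod_range_zero]
  rw [FInvPow_smul, FInvPow_smul, hw.FInvPow_one, LinearMap.map_smul₂, LinearMap.map_smul,
    diagForm_self, h]

theorem isInvariant_diagForm_gramLoc (hw : IsHighestWeightVector w) :
    IsInvariant (diagForm hw.basisLoc (gramLoc k)) :=
  isInvariant_diagForm_int _ hw.isFString _ (gramLoc_succ k)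

theorem isLift_diagForm (hw : IsHighestWeightVector w) {φ : M k →ₗ[R k] M k →ₗ[R k] R k}
    (hφ : IsShapovalovForm w φ) : IsLift φ (diagForm hw.basisLoc (gramLoc k)) where
  invariant := isInvariant_diagForm_gramLoc hw
  vanish_left := diagForm_iota_left hw
  vanish_right := diagForm_iota_right hw
  lift a b ha hb := by
    obtain ⟨α, hα⟩ := hw.exists_eq_smul ha.hasWt
    obtain ⟨β, hβ⟩ := hw.exists_eq_smul hb.hasWt
    rw [hα, hβ, diagForm_FInvPow, LinearMap.map_smul₂, LinearMap.map_smul, hφ.normalized]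

theorem IsLift.formPi_basisPi (hw : IsHighestWeightVector w) {φ : M k →ₗ[R k] M k →ₗ[R k] R k}
    {φF : LocF k (M k) →ₗ[R k] LocF k (M k) →ₗ[R k] R k} (h : IsLift φ φF) (i j : ℕ) :
    h.formPi (hw.basisPi i) (hw.basisPi j) =
      φF (hw.basisLoc (Int.negSucc i)) (hw.basisLoc (Int.negSucc j)) := by
  rw [hw.basisPi_eq_mk, hw.basisPi_eq_mk, hw.basisLoc_apply, hw.basisLoc_apply]
  exact piForm_mk φF h.vanish_left h.vanish_right _ _

theorem IsLift.formPi_self (hw : IsHighestWeightVector w) {φ : M k →ₗ[R k] M k →ₗ[R k] R k}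
    (hφ : IsShapovalovForm w φ) {φF : LocF k (M k) →ₗ[R k] LocF k (M k) →ₗ[R k] R k}
    (h : IsLift φ φF) (j : ℕ) : h.formPi (hw.basisPi j) (hw.basisPi j) = gramPi k j := by
  rw [h.formPi_basisPi hw, h.eq_diagForm hw hφ, diagForm_self]
  rfl

theorem IsLift.formPi_of_ne (hw : IsHighestWeightVector w) {φ : M k →ₗ[R k] M k →ₗ[R k] R k}
    (hφ : IsShapovalovForm w φ) {φF : LocF k (M k) →ₗ[R k] LocF k (M k) →ₗ[R k] R k}
    (h : IsLift φ φF) {i j : ℕ} (hij : i ≠ j) : h.formPi (hw.basisPi i) (hw.basisPi j) = 0 := by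
  rw [h.formPi_basisPi hw, h.eq_diagForm hw hφ]
  exact diagForm_of_ne _ _ (by simpa using hij)

end Shapovalov

/-! ### Comparison of the Gram coefficients -/

section Coefficients

variable (k : Type u) [Field k]

theorem s_smul (c : RatFunc k) (f : R k) : s k (c • f) = c • s k f := map_smul _ _ _

theorem s_qT (r : ℤ) : s k (qT k r) = -qT k (-r) := by
  rw [qT, qT, s_smul, map_sub, s_smul, s_smul, s_T, s_Tinv, neg_neg, ← smul_neg, neg_sub]

/-- The scalar of `F⁻ʲ m` in `Fʲ` applied to the highest weight vector of the twist of `M_π`. -/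
def twistCoeff (j : ℕ) : R k := ∏ i ∈ Finset.range j, -(wt k (-(i + 1)) * eCoeff k (-(i + 1)))

theorem twistCoeff_succ (j : ℕ) :
    twistCoeff k (j + 1) = -(wt k (-(j + 1)) * eCoeff k (-(j + 1))) * twistCoeff k j := by
  rw [twistCoeff, Finset.prod_range_succ, mul_comm, twistCoeff]

/-- The coefficient of `Fʲ w` in `Ψ(F⁻ʲ m)`. -/
def psiCoeff (j : ℕ) : R k :=
  ((-1) ^ j * v k ^ (-(j : ℤ) ^ 2) * (qFact k j)⁻¹) • T k ^ j * (qTFalling k (-1) j)⁻¹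

theorem qInt_neg (n : ℤ) : qInt k (-n) = -qInt k n := by
  rw [qInt, qInt, neg_neg, ← neg_div, neg_sub]

theorem psiCoeff_succ (j : ℕ) : psiCoeff k (j + 1) = psiCoeff k j *
    (-(v k ^ (-1 - 2 * (j : ℤ)) * (qInt k (j + 1))⁻¹) • (T k * (qT k (-(j + 1)))⁻¹)) := by
  have h1 : -((j + 1 : ℕ) : ℤ) ^ 2 = -(j : ℤ) ^ 2 + (-1 - 2 * (j : ℤ)) := by push_cast; ring
  have h2 : (-1 - (j : ℤ)) = -(j + 1) := by ring
  rw [psiCoeff, psiCoeff, qTFalling, Finset.prod_range_succ, PowerSeries.mul_inv_rev, qFact_succ, h1,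
    zpow_add₀ (v_ne_zero k), h2, ← qTFalling]
  simp only [Algebra.smul_def, map_mul, map_neg, map_pow, map_one, mul_inv, pow_succ]
  ring

theorem psiCoeff_mul (j : ℕ) : psiCoeff k j * s k (twistCoeff k j) = 1 := by
  induction j with
  | zero => simp [psiCoeff, twistCoeff, qFact, qTFalling]
  | succ j ih =>
    have hq : (qT k (-(j + 1)))⁻¹ * qT k (-(j + 1)) = 1 :=
      PowerSeries.inv_mul_cancel _ ((isUnit_iff_constantCoeff k).mp (isUnit_qT k (by omega)))
    have hT := T_mul_Tinv k
    have hi : algebraMap (RatFunc k) (R k) (qInt k (j + 1))⁻¹ *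
        algebraMap (RatFunc k) (R k) (qInt k (j + 1)) = 1 := by
      rw [← map_mul, inv_mul_cancel₀ (qInt_ne_zero k (by omega)), map_one]
    have hv : algebraMap (RatFunc k) (R k) (v k ^ (-1 - 2 * (j : ℤ))) *
        algebraMap (RatFunc k) (R k) (v k ^ (-1 - 2 * (-((j : ℤ) + 1)))) = 1 := by
      rw [← map_mul, ← zpow_add₀ (v_ne_zero k)]
      have : (-1 - 2 * (j : ℤ)) + (-1 - 2 * (-((j : ℤ) + 1))) = 0 := by ring
      rw [this, zpow_zero, map_one]
    rw [psiCoeff_succ, twistCoeff_succ, map_mul, map_neg, map_mul, wt, eCoeff, s_smul, s_smul, s_T,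
      s_qT, neg_neg, qInt_neg]
    simp only [Algebra.smul_def, map_mul, map_neg]
    -- The factors that `j + 1` adds to the two products are inverse to each other.
    linear_combination ih + psiCoeff k j * s k (twistCoeff k j) * ((T k * (T k)⁻¹) *
      ((qT k (-(j + 1)))⁻¹ * qT k (-(j + 1))) * (algebraMap (RatFunc k) (R k) (qInt k (j + 1))⁻¹ *
        algebraMap (RatFunc k) (R k) (qInt k (j + 1))) * hv + (T k * (T k)⁻¹) *
      ((qT k (-(j + 1)))⁻¹ * qT k (-(j + 1))) * hi + (T k * (T k)⁻¹) * hq + hT)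

theorem s_psiCoeff_mul (j : ℕ) : s k (psiCoeff k j) * twistCoeff k j = 1 := by
  have := congrArg (s k) (psiCoeff_mul k j)
  rwa [map_mul, s_s, map_one] at this

/-- The coefficient of `Fⁿ a ⊗ Fⁿ b` in `L(a ⊗ b)`, for `b` in the module twisted by `ρ₁`. -/
def lCoeff (n : ℕ) : RatFunc k :=
  (-1) ^ n * v k ^ (-((n : ℤ) * (n - 1) / 2)) * qBrace k n *
    ((qFact k n)⁻¹ * ((qFact k n)⁻¹ * (-v k) ^ n))

theorem lCoeff_succ (n : ℕ) : lCoeff k (n + 1) = lCoeff k n *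
    (v k * (v k ^ n)⁻¹ * (v k ^ (n + 1) - (v k ^ (n + 1))⁻¹) * (qInt k (n + 1))⁻¹ ^ 2) := by
  have h1 : -(((n + 1 : ℕ) : ℤ) * ((n + 1 : ℕ) - 1) / 2) = -((n : ℤ) * (n - 1) / 2) + -n := by
    have : ((n + 1 : ℕ) : ℤ) * ((n + 1 : ℕ) - 1) = n * (n - 1) + n * 2 := by push_cast; ring
    rw [this, Int.add_mul_ediv_right _ _ (by norm_num)]
    ring
  rw [lCoeff, lCoeff, h1, zpow_add₀ (v_ne_zero k), qFact_succ, qBrace,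
    Finset.prod_Icc_succ_top (by omega), ← qBrace, zpow_neg _ (n : ℤ), zpow_natCast, mul_inv]
  ring

/-- The image of `v` in the field of fractions of `R`. -/
abbrev vF : FractionRing (R k) := scalarF k (v k)

/-- The image of `T` in the field of fractions of `R`. -/
abbrev tF : FractionRing (R k) := toFrac k (T k)

/-- The image of `v - v⁻¹` in the field of fractions of `R`. -/
abbrev dF : FractionRing (R k) := vF k - (vF k)⁻¹

theorem vF_ne_zero : vF k ≠ 0 := scalarF_ne_zero k (v_ne_zero k)

theorem tF_ne_zero : tF k ≠ 0 := toFrac_ne_zero k (isUnit_T k).ne_zero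

theorem dF_ne_zero : dF k ≠ 0 := by
  have := scalarF_ne_zero k (v_sub_inv_ne_zero k)
  rwa [map_sub, map_inv₀] at this

theorem scalarF_qInt (n : ℕ) : scalarF k (qInt k n) = brace (vF k) n / dF k := by
  rw [qInt, map_div₀, map_sub, map_sub, map_zpow₀, map_zpow₀, map_inv₀, zpow_neg, zpow_natCast, brace]

theorem brace_vF_ne_zero (n : ℕ) (hn : 0 < n) : brace (vF k) n ≠ 0 := by
  have h := scalarF_ne_zero k (qInt_ne_zero k (n := n) (by omega))
  rw [scalarF_qInt] at h
  intro h0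
  rw [h0, zero_div] at h
  exact h rfl

theorem braceFact_vF_ne_zero (n : ℕ) : braceFact (vF k) n ≠ 0 :=
  Finset.prod_ne_zero_iff.mpr fun i _ => brace_vF_ne_zero k _ (by omega)

theorem toFrac_qT (n : ℕ) :
    toFrac k (qT k n) = (tF k)⁻¹ * braceAt (vF k) (tF k ^ 2) n / dF k := by
  have ht := tF_ne_zero k
  rw [qT, toFrac_smul, map_sub, toFrac_smul, toFrac_smul, toFrac_inv k (isUnit_T k), map_inv₀, map_sub,
    map_zpow₀, map_zpow₀, map_inv₀, zpow_neg, zpow_natCast, braceAt]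
  generalize (vF k ^ n)⁻¹ = z
  field_simp

theorem braceAt_ne_zero (n : ℕ) (hn : 0 < n) : braceAt (vF k) (tF k ^ 2) n ≠ 0 := by
  have h := toFrac_ne_zero k (isUnit_qT k (r := n) (by omega)).ne_zero
  rw [toFrac_qT] at h
  intro h0
  rw [h0, mul_zero, zero_div] at h
  exact h rfl

theorem toFrac_eCoeff_neg (n : ℕ) : toFrac k (eCoeff k (-n)) =
    -(brace (vF k) n * (tF k)⁻¹ * braceAt (vF k) (tF k ^ 2) n / dF k ^ 2) := by
  rw [eCoeff, toFrac_smul, neg_neg, qInt_neg, map_neg, scalarF_qInt, toFrac_qT]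
  generalize dF k = d
  ring

theorem toFrac_gramStep_neg (n : ℕ) : toFrac k (gramStep k (-n)) =
    -((vF k ^ (2 * n))⁻¹ * (tF k ^ 2)⁻¹ * brace (vF k) n * braceAt (vF k) (tF k ^ 2) n / dF k ^ 2) := by
  rw [gramStep, toFrac_smul, map_mul, toFrac_eCoeff_neg, toFrac_inv k (isUnit_T k), map_zpow₀]
  have : (2 * -(n : ℤ)) = -((2 * n : ℕ) : ℤ) := by push_cast; ring
  rw [this, zpow_neg, zpow_natCast]
  ring

theorem toFrac_s_gramStep (n : ℕ) : toFrac k (s k (gramStep k n)) =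
    -(vF k ^ (2 * n) * brace (vF k) n * braceAt (vF k) (tF k ^ 2) n / dF k ^ 2) := by
  have ht := tF_ne_zero k
  rw [gramStep, s_smul, map_mul, s_Tinv, eCoeff, s_smul, s_qT, neg_neg, toFrac_smul, map_mul,
    toFrac_smul, map_neg, toFrac_qT, scalarF_qInt, map_zpow₀]
  have : (2 * (n : ℤ)) = ((2 * n : ℕ) : ℤ) := by push_cast; ring
  rw [this, zpow_natCast]
  generalize dF k = d
  field_simp

theorem toFrac_wt_neg (n : ℕ) : toFrac k (wt k (-n)) = (vF k)⁻¹ * vF k ^ (2 * n) * tF k := by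
  rw [wt, toFrac_smul, map_zpow₀]
  have : (-1 - 2 * -(n : ℤ)) = -1 + ((2 * n : ℕ) : ℤ) := by push_cast; ring
  rw [this, zpow_add₀ (vF_ne_zero k), zpow_natCast, zpow_neg_one]

/-- `∏_{i=1}^n (vⁱ T² - v⁻ⁱ)`. -/
def braceAtFact (n : ℕ) : FractionRing (R k) :=
  ∏ i ∈ Finset.range n, braceAt (vF k) (tF k ^ 2) (i + 1)

theorem braceAtFact_ne_zero (n : ℕ) : braceAtFact k n ≠ 0 :=
  Finset.prod_ne_zero_iff.mpr fun i _ => braceAt_ne_zero k _ (by omega)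

theorem braceAtFact_succ (n : ℕ) :
    braceAtFact k (n + 1) = braceAtFact k n * braceAt (vF k) (tF k ^ 2) (n + 1) :=
  Finset.prod_range_succ _ _

/-- The factor `(-1)ⁿ v^{n - n(n-1)/2}`. -/
def aSeq (n : ℕ) : FractionRing (R k) := ∏ i ∈ Finset.range n, -(vF k * (vF k ^ i)⁻¹)

/-- The factor `v^{n(n+1)}`. -/
def gSeq (n : ℕ) : FractionRing (R k) := ∏ i ∈ Finset.range n, vF k ^ (2 * i + 2)

/-- The factor `v^{n-n²}`. -/
def rSeq (n : ℕ) : FractionRing (R k) := ∏ i ∈ Finset.range n, (vF k ^ (2 * i))⁻¹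

theorem scalarF_lCoeff (n : ℕ) :
    scalarF k (lCoeff k n) = (-1) ^ n * aSeq k n * dF k ^ (2 * n) / braceFact (vF k) n := by
  induction n with
  | zero => simp [lCoeff, aSeq, braceFact, qBrace, qFact]
  | succ n ih =>
    have hb := brace_vF_ne_zero k (n + 1) (by omega)
    have hB := braceFact_vF_ne_zero k n
    have hd := dF_ne_zero k
    have hv := vF_ne_zero k
    have hq : scalarF k (qInt k (n + 1)) = brace (vF k) (n + 1) / dF k := by
      exact_mod_cast scalarF_qInt k (n + 1)
    have hbr : scalarF k (v k ^ (n + 1) - (v k ^ (n + 1))⁻¹) = brace (vF k) (n + 1) := by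
      rw [map_sub, map_inv₀, map_pow, brace]
    rw [lCoeff_succ, map_mul, ih, map_mul, map_mul, hbr, map_pow, map_inv₀, hq, map_mul, map_inv₀,
      map_pow, aSeq, aSeq, Finset.prod_range_succ, braceFact_succ]
    generalize brace (vF k) (n + 1) = b at *
    generalize dF k = d at *
    field_simp
    ring

theorem toFrac_gramPi (m : ℕ) : toFrac k (gramPi k m) =
    (-1) ^ m * gSeq k m * tF k ^ (2 * m) * dF k ^ (2 * m) /
      (braceFact (vF k) m * braceAtFact k m) := by
  induction m with
  | zero => simp [gramPi, gSeq, braceFact, braceAtFact]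
  | succ m ih =>
    have hb := brace_vF_ne_zero k (m + 1) (by omega)
    have hf := braceAt_ne_zero k (m + 1) (by omega)
    have hB := braceFact_vF_ne_zero k m
    have hF := braceAtFact_ne_zero k m
    have hd := dF_ne_zero k
    have hv := vF_ne_zero k
    have ht := tF_ne_zero k
    have hs := toFrac_gramStep_neg k (m + 1)
    rw [gramPi, Finset.prod_range_succ, ← gramPi, map_mul, ih,
      toFrac_inv k (isUnit_gramStep k (by omega))]
    push_cast at hs
    rw [hs, gSeq, gSeq, Finset.prod_range_succ, braceFact_succ, braceAtFact_succ]
    generalize brace (vF k) (m + 1) = b at *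
    generalize braceAt (vF k) (tF k ^ 2) (m + 1) = b at *
    generalize dF k = d at *
    field_simp
    ring

/-- The image under `s` of the coefficient of the Shapovalov form transported by `Ψ`. -/
theorem toFrac_s_gramM (j : ℕ) : toFrac k (s k (psiCoeff k j * (psiCoeff k j * gramM k j))) =
    (-1) ^ j * rSeq k j * dF k ^ (2 * j) / (braceFact (vF k) j * braceAtFact k j) := by
  have h1 : toFrac k (s k (psiCoeff k j)) = (toFrac k (twistCoeff k j))⁻¹ := by
    refine eq_inv_of_mul_eq_one_left ?_
    rw [← map_mul, s_psiCoeff_mul, map_one]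
  rw [map_mul, map_mul, map_mul, map_mul, h1]
  clear h1
  induction j with
  | zero => simp [twistCoeff, gramM, rSeq, braceFact, braceAtFact]
  | succ j ih =>
    have hb := brace_vF_ne_zero k (j + 1) (by omega)
    have hf := braceAt_ne_zero k (j + 1) (by omega)
    have hB := braceFact_vF_ne_zero k j
    have hF := braceAtFact_ne_zero k j
    have hd := dF_ne_zero k
    have hv := vF_ne_zero k
    have ht := tF_ne_zero k
    have hs := toFrac_s_gramStep k (j + 1)
    have he := toFrac_eCoeff_neg k (j + 1)
    have hw := toFrac_wt_neg k (j + 1)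
    push_cast at hs he hw
    rw [twistCoeff_succ, gramM_succ, map_mul (s k), map_mul, map_mul, map_neg, map_mul, hs, he, hw]
    have hsplit : ∀ x y a c : FractionRing (R k), (x * a)⁻¹ * ((x * a)⁻¹ * (y * c))
        = (x⁻¹ * (x⁻¹ * y)) * (a⁻¹ * (a⁻¹ * c)) := by
      intro x y a c; rw [mul_inv]; ring
    rw [hsplit, ih, rSeq, rSeq, Finset.prod_range_succ, braceFact_succ, braceAtFact_succ]
    generalize brace (vF k) (j + 1) = b at *
    generalize braceAt (vF k) (tF k ^ 2) (j + 1) = b at *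
    generalize dF k = d at *
    field_simp
    ring

theorem braceAtFact_add (n m : ℕ) : braceAtFact k (n + m) =
    braceAtFact k m * ∏ i ∈ Finset.range n, braceAt (vF k) (tF k ^ 2) (m + 1 + i) := by
  rw [braceAtFact, add_comm n m, Finset.prod_range_add, ← braceAtFact]
  congr 1
  exact Finset.prod_congr rfl fun i _ => by congr 1; omega

/-- The identity of Gram coefficients behind `s ∘ φ_π ∘ L = φ ∘ (Ψ ⊗ Ψ)`: after extraction of the
common factor it is the `q`-Chu–Vandermonde sum at `x = T²`. -/
theorem sum_lCoeff_mul_gramPi (j : ℕ) :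
    ∑ p ∈ Finset.HasAntidiagonal.antidiagonal j,
      algebraMap (RatFunc k) (R k) (lCoeff k p.1) * gramPi k p.2 =
    s k (psiCoeff k j * (psiCoeff k j * gramM k j)) := by
  apply toFrac_injective
  rw [toFrac_s_gramM, map_sum]
  have hsum := sum_qTerm (vF_ne_zero k) (brace_vF_ne_zero k) (a := aSeq k) (g := gSeq k) (r := rSeq k)
    (by simp [aSeq])
    (fun n => by rw [aSeq, Finset.prod_range_succ, ← aSeq]; ring)
    (by simp [gSeq]) (fun n => by rw [gSeq, Finset.prod_range_succ, ← gSeq])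
    (by simp [rSeq]) (fun n => by rw [rSeq, Finset.prod_range_succ, ← rSeq]) j (tF k ^ 2)
  have hF := braceAtFact_ne_zero k j
  have hB := braceFact_vF_ne_zero k j
  have h : (-1) ^ j * rSeq k j * dF k ^ (2 * j) / (braceFact (vF k) j * braceAtFact k j)
      = (-1) ^ j * dF k ^ (2 * j) / braceAtFact k j * (rSeq k j / braceFact (vF k) j) := by
    generalize dF k = d
    field_simp
  rw [h, ← hsum, Finset.mul_sum]
  refine Finset.sum_congr rfl fun p hp => ?_
  obtain ⟨n, m⟩ := p
  obtain rfl : n + m = j := Finset.HasAntidiagonal.mem_antidiagonal.mp hp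
  have hFm := braceAtFact_ne_zero k m
  have hBn := braceFact_vF_ne_zero k n
  have hBm := braceFact_vF_ne_zero k m
  rw [braceAtFact_add] at hF ⊢
  have hP := right_ne_zero_of_mul hF
  simp only
  rw [map_mul, toFrac_algebraMap, scalarF_lCoeff, toFrac_gramPi, qTerm]
  generalize dF k = d
  field_simp
  ring

end Coefficients

/-! ### The action of `U` on `M_π` -/

section PiAction

variable {k : Type u} [Field k] {A : Type u} [AddCommGroup A] [Module (UR k) A] [Module (R k) A]
  [IsScalarTower (R k) (UR k) A]

/-- The vectors `p j` behave like the classes of `F⁻¹⁻ʲ w`, `j ∈ ℕ`, in the localization of a module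
modulo the module, for a singular vector `w` of weight `T v⁻¹`. -/
structure IsPiString (p : ℕ → A) : Prop where
  F_zero : inU k (F k) • p 0 = 0
  F_succ : ∀ j, inU k (F k) • p (j + 1) = p j
  hasWt : ∀ j : ℕ, HasWt (k := k) (-(j + 1)) (p j)
  E_smul : ∀ j : ℕ, inU k (E k) • p j = eCoeff k (-(j + 1)) • p (j + 1)

theorem IsFString.isPiString {b : ℤ → A} (hb : IsFString (k := k) b) (N : Submodule (UR k) A)
    (h0 : b 0 ∈ N) :
    IsPiString (k := k) fun j : ℕ => (Submodule.Quotient.mk (b (Int.negSucc j)) : A ⧸ N) where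
  F_zero := by
    rw [← Submodule.Quotient.mk_smul, hb.F_smul]
    exact (Submodule.Quotient.mk_eq_zero N).mpr h0
  F_succ j := by
    rw [← Submodule.Quotient.mk_smul, hb.F_smul]
    rfl
  hasWt j := by
    have h : Int.negSucc j = -((j : ℤ) + 1) := Int.negSucc_eq j
    rw [HasWt, ← Submodule.Quotient.mk_smul, ← Submodule.Quotient.mk_smul, ← h, hb.hasWt]
  E_smul j := by
    have h : Int.negSucc j = -((j : ℤ) + 1) := Int.negSucc_eq j
    have h' : Int.negSucc (j + 1) = Int.negSucc j - 1 := by omega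
    rw [← Submodule.Quotient.mk_smul, ← Submodule.Quotient.mk_smul, hb.E_smul, h', h]

theorem IsHighestWeightVector.isPiString {w : M k} (hw : IsHighestWeightVector w) :
    IsPiString (k := k) hw.basisPi := by
  have h : ⇑hw.basisPi = fun j : ℕ =>
      (Submodule.Quotient.mk (hw.basisLoc (Int.negSucc j)) : Pi k (M k)) := by
    funext j
    rw [hw.basisPi_eq_mk, hw.basisLoc_apply]
  rw [h]
  exact hw.isFString.isPiString _ ⟨hw.basis 0, hw.iota_basis 0⟩

/-! ### The nondegenerate cycle -/

theorem sTprime_algebraMap (r : R k) :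
    (sTprime k : UR k →+* UR k) (algebraMap (R k) (UR k) r) = algebraMap (R k) (UR k) (s k r) := by
  change sTprime k (r ⊗ₜ 1) = s k r ⊗ₜ 1
  rw [sTprime, Algebra.TensorProduct.map_tmul, map_one]

theorem sTprime_inU (u : U k) : (sTprime k : UR k →+* UR k) (inU k u) = inU k (Tprime k u) := by
  change sTprime k (1 ⊗ₜ u) = 1 ⊗ₜ Tprime k u
  rw [sTprime, Algebra.TensorProduct.map_tmul, map_one]

theorem smul_toTwist_sTprime (r : R k) (a : A) :
    algebraMap (R k) (UR k) r • toTwist (sTprime k : UR k →+* UR k) A a =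
      toTwist (sTprime k : UR k →+* UR k) A (s k r • a) := by
  rw [smul_toTwist, sTprime_algebraMap, algebraMap_smul]

theorem toTwist_smul (r : R k) (a : A) : toTwist (sTprime k : UR k →+* UR k) A (r • a) =
    algebraMap (R k) (UR k) (s k r) • toTwist (sTprime k : UR k →+* UR k) A a := by
  rw [smul_toTwist_sTprime, s_s]

theorem inU_smul_toTwist (u : U k) (a : A) : inU k u • toTwist (sTprime k : UR k →+* UR k) A a =
    toTwist (sTprime k : UR k →+* UR k) A (inU k (Tprime k u) • a) := by
  rw [smul_toTwist, sTprime_inU]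

theorem Tprime_E : Tprime k (E k) = -(Kinv k * F k) := by rw [Tprime, liftU_gen]; rfl

theorem Tprime_F : Tprime k (F k) = -(E k * K k) := by rw [Tprime, liftU_gen]; rfl

theorem Tprime_K : Tprime k (K k) = Kinv k := by rw [Tprime, liftU_gen]; rfl

variable {p : ℕ → A}

/-- The class `m` of `F⁻¹ w` is singular of weight `T v⁻¹` for the twisted action. -/
theorem IsPiString.isSingular_toTwist (hp : IsPiString (k := k) p) :
    IsSingular k (-1) (toTwist (sTprime k : UR k →+* UR k) A (p 0)) where
  E_smul := by
    rw [inU_smul_toTwist, Tprime_E, map_neg, neg_smul, map_mul, mul_smul, hp.F_zero, smul_zero,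
      neg_zero, map_zero]
  K_smul := by
    rw [inU_smul_toTwist, Tprime_K, (hp.hasWt 0).Kinv_smul, smul_toTwist_sTprime, s_smul, s_T, wtInv]
    rfl

theorem IsPiString.F_pow_smul_toTwist (hp : IsPiString (k := k) p) (j : ℕ) :
    inU k (F k) ^ j • toTwist (sTprime k : UR k →+* UR k) A (p 0) =
      toTwist (sTprime k : UR k →+* UR k) A (twistCoeff k j • p j) := by
  induction j with
  | zero => rw [pow_zero, one_smul, twistCoeff, Finset.prod_range_zero, one_smul]
  | succ j ih =>
    rw [pow_succ_smul, ih, inU_smul_toTwist, Tprime_F, map_neg, neg_smul, map_mul, mul_smul,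
      inU_smul_comm, inU_smul_comm, hp.hasWt, inU_smul_comm, hp.E_smul, twistCoeff_succ, smul_smul,
      smul_smul, neg_mul, neg_smul, mul_comm (twistCoeff k j), mul_assoc,
      mul_comm (twistCoeff k j), mul_assoc]

end PiAction

section Cycle

variable {k : Type u} [Field k] {A B : Type u}
  [AddCommGroup A] [Module (UR k) A] [Module (R k) A] [IsScalarTower (R k) (UR k) A]
  [AddCommGroup B] [Module (UR k) B] [Module (R k) B] [IsScalarTower (R k) (UR k) B]

/-- A homomorphism to the twist of `A` that maps a basis, up to units, to a basis of `A` is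
bijective. -/
theorem bijective_of_basis (b : Module.Basis ℕ (R k) B) (p : Module.Basis ℕ (R k) A)
    (Φ : B →ₗ[UR k] Twist (sTprime k : UR k →+* UR k) A) (d e : ℕ → R k)
    (hd : ∀ j, Φ (b j) = toTwist (sTprime k : UR k →+* UR k) A (d j • p j))
    (hde : ∀ j, e j * d j = 1) : Function.Bijective Φ := by
  constructor
  · have key : ∀ x j, p.repr ((toTwist (sTprime k : UR k →+* UR k) A).symm (Φ x)) j =
        d j * s k (b.repr x j) := by
      intro x j
      induction b.mem_span x using Submodule.span_induction with
      | zero => simp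
      | add x y _ _ hx hy =>
        rw [map_add, map_add, map_add, map_add, Finsupp.add_apply, Finsupp.add_apply, hx, hy, map_add,
          mul_add]
      | smul r x _ hx =>
        obtain ⟨a, ha⟩ := (toTwist (sTprime k : UR k →+* UR k) A).surjective (Φ x)
        rw [← algebraMap_smul (UR k) r x, map_smul, ← ha, smul_toTwist_sTprime,
          AddEquiv.symm_apply_apply, algebraMap_smul, map_smul p.repr, map_smul b.repr,
          Finsupp.smul_apply, Finsupp.smul_apply, smul_eq_mul, smul_eq_mul, map_mul, mul_left_comm,
          ← hx, ← ha, AddEquiv.symm_apply_apply]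
      | mem x hx =>
        obtain ⟨i, rfl⟩ := hx
        rw [hd, AddEquiv.symm_apply_apply, map_smul p.repr, Module.Basis.repr_self,
          Module.Basis.repr_self, Finsupp.smul_apply, smul_eq_mul]
        by_cases h : i = j
        · subst h; rw [Finsupp.single_eq_same, map_one]
        · rw [Finsupp.single_eq_of_ne (Ne.symm h), mul_zero, map_zero, mul_zero]
    rw [injective_iff_map_eq_zero]
    intro x hx
    apply b.repr.injective
    ext1 j
    have h := key x j
    rw [hx, map_zero, map_zero, Finsupp.zero_apply] at h
    have h1 : s k (b.repr x j) = 0 := by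
      rw [← one_mul (s k _), ← hde j, mul_assoc, ← h, mul_zero]
    rw [map_zero, Finsupp.zero_apply]
    exact (s_bijective k).1 (h1.trans (map_zero _).symm)
  · intro y
    obtain ⟨a, rfl⟩ := (toTwist (sTprime k : UR k →+* UR k) A).surjective y
    change _ ∈ Set.range Φ
    rw [← LinearMap.coe_range, SetLike.mem_coe]
    induction p.mem_span a using Submodule.span_induction with
    | zero => rw [map_zero]; exact Submodule.zero_mem _
    | add x y _ _ hx hy => rw [map_add]; exact Submodule.add_mem _ hx hy
    | smul r x _ hx => rw [toTwist_smul]; exact Submodule.smul_mem _ _ hx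
    | mem x hx =>
      obtain ⟨i, rfl⟩ := hx
      have h := toTwist_smul (e i) (d i • p i)
      rw [smul_smul, hde, one_smul, ← hd] at h
      rw [h]
      exact Submodule.smul_mem _ _ ⟨_, rfl⟩

/-- An isomorphism from the twist of `A` is determined by its values on a basis of `A`. -/
theorem twist_ext (p : Module.Basis ℕ (R k) A)
    {Ψ Ψ' : Twist (sTprime k : UR k →+* UR k) A ≃ₗ[UR k] B}
    (h : ∀ j, Ψ (toTwist _ _ (p j)) = Ψ' (toTwist _ _ (p j))) : Ψ = Ψ' := by
  refine LinearEquiv.ext fun y => ?_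
  obtain ⟨a, rfl⟩ := (toTwist (sTprime k : UR k →+* UR k) A).surjective y
  induction p.mem_span a using Submodule.span_induction with
  | zero => rw [map_zero, map_zero, map_zero]
  | add x y _ _ hx hy => rw [map_add, map_add, map_add, hx, hy]
  | smul r x _ hx => rw [toTwist_smul, map_smul, map_smul, hx]
  | mem x hx =>
    obtain ⟨i, rfl⟩ := hx
    exact h i

theorem exists_cycle (b : Module.Basis ℕ (R k) B) (p : Module.Basis ℕ (R k) A)
    (Φ : B →ₗ[UR k] Twist (sTprime k : UR k →+* UR k) A)
    (hd : ∀ j, Φ (b j) = toTwist (sTprime k : UR k →+* UR k) A (twistCoeff k j • p j)) :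
    ∃ Ψ : Twist (sTprime k : UR k →+* UR k) A ≃ₗ[UR k] B,
      ∀ j, Ψ (toTwist _ _ (p j)) = psiCoeff k j • b j := by
  have hbij := bijective_of_basis b p Φ (twistCoeff k) (fun j => s k (psiCoeff k j)) hd
    (s_psiCoeff_mul k)
  refine ⟨(LinearEquiv.ofBijective Φ hbij).symm, fun j => ?_⟩
  rw [LinearEquiv.symm_apply_eq, LinearEquiv.ofBijective_apply, ← algebraMap_smul (UR k), map_smul, hd,
    smul_toTwist_sTprime, smul_smul, s_psiCoeff_mul, one_smul]

variable {w : M k}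

theorem isVermaCycle_iff (hw : IsHighestWeightVector w) (Ψ : NondegenerateCycle k (M k)) :
    IsVermaCycle w Ψ ↔ ∀ j, Ψ (toTwist _ _ (hw.basisPi j)) = psiCoeff k j • hw.basis j := by
  refine forall_congr' fun j => ?_
  rw [hw.basisPi_apply, hw.basis_apply, psiCoeff]

theorem existsUnique_isVermaCycle (hw : IsHighestWeightVector w) :
    ∃! Ψ : NondegenerateCycle k (M k), IsVermaCycle w Ψ := by
  obtain ⟨Φ, hΦ⟩ := hw.exists_lift hw.isPiString.isSingular_toTwist
  obtain ⟨Ψ, hΨ⟩ := exists_cycle hw.basis hw.basisPi Φ fun j => by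
    rw [hw.basis_apply, ← map_pow, map_smul, hΦ, map_pow, hw.isPiString.F_pow_smul_toTwist]
  refine ⟨Ψ, (isVermaCycle_iff hw Ψ).mpr hΨ, fun Ψ' hΨ' => ?_⟩
  refine twist_ext hw.basisPi fun j => ?_
  rw [hΨ, (isVermaCycle_iff hw Ψ').mp hΨ']

end Cycle

/-! ### Lusztig's map on `M_π ⊗ M_π^{ρ₁}` -/

section Lusztig

variable {k : Type u} [Field k] {A : Type u} [AddCommGroup A] [Module (UR k) A] [Module (R k) A]
  [IsScalarTower (R k) (UR k) A]

theorem rho1_E : rho1 k (E k) = -(v k • F k) := by rw [rho1, liftU_gen]; rfl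

theorem rho1_divPow_E (n : ℕ) :
    rho1 k (divPow k (E k) n) = ((qFact k n)⁻¹ * (-v k) ^ n) • F k ^ n := by
  rw [divPow, map_smul, map_pow, rho1_E, ← neg_smul, smul_pow, smul_smul]

theorem inU_smul_toTwistRho1 (u : U k) (a : A) :
    inU k u • toTwistRho1 (k := k) A a = toTwistRho1 A (inU k (rho1 k u) • a) := by
  have h : rho1R k (inU k u) = inU k (rho1 k u) := by
    change rho1R k (1 ⊗ₜ u) = 1 ⊗ₜ rho1 k u
    rw [rho1R, Algebra.TensorProduct.map_tmul, map_one]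
  rw [← h]
  rfl

theorem inU_divPow_F_smul (n : ℕ) (a : A) : inU k (divPow k (F k) n) • a =
    algebraMap (RatFunc k) (R k) (qFact k n)⁻¹ • inU k (F k) ^ n • a := by
  rw [divPow, inU_smul_smul, map_pow]

theorem formTensor_LTerm (χ : A →ₗ[R k] A →ₗ[R k] R k) (n : ℕ) (a b : A) :
    formTensor χ (LTerm n a (toTwistRho1 A b)) =
      algebraMap (RatFunc k) (R k) (lCoeff k n) * χ (inU k (F k) ^ n • a) (inU k (F k) ^ n • b) := by
  rw [LTerm, inU_smul_toTwistRho1, rho1_divPow_E, inU_smul_smul, map_pow, inU_divPow_F_smul, map_smul,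
    formTensor_tmul, LinearMap.map_smul₂, LinearMap.map_smul, lCoeff]
  simp only [smul_eq_mul, map_mul, mul_assoc]

theorem IsPiString.F_pow_smul {p : ℕ → A} (hp : IsPiString (k := k) p) (n j : ℕ) :
    inU k (F k) ^ n • p (n + j) = p j := by
  induction n with
  | zero => rw [pow_zero, one_smul, zero_add]
  | succ n ih => rw [← pow_smul_smul, Nat.add_right_comm, hp.F_succ, ih]

theorem IsPiString.F_pow_smul_eq_zero {p : ℕ → A} (hp : IsPiString (k := k) p) {n j : ℕ} (h : j < n) :
    inU k (F k) ^ n • p j = 0 := by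
  obtain ⟨m, rfl⟩ := Nat.exists_eq_add_of_lt h
  have h1 := hp.F_pow_smul j 0
  rw [add_zero] at h1
  have h2 : j + m + 1 = m + (j + 1) := by omega
  rw [h2, pow_add, mul_smul, pow_succ_smul, h1, hp.F_zero, smul_zero]

theorem formTensor_L (hA : FLocallyNilpotent k A) (χ : A →ₗ[R k] A →ₗ[R k] R k) {p : ℕ → A}
    (hp : IsPiString (k := k) p) (i j : ℕ) :
    formTensor χ (L hA (p i ⊗ₜ[R k] toTwistRho1 A (p j))) =
      ∑ n ∈ Finset.range (i + 1), algebraMap (RatFunc k) (R k) (lCoeff k n) *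
        χ (inU k (F k) ^ n • p i) (inU k (F k) ^ n • p j) := by
  rw [L_tmul, finsum_eq_sum_of_support_subset (s := Finset.range (i + 1)), map_sum]
  · exact Finset.sum_congr rfl fun n _ => formTensor_LTerm χ n _ _
  · intro n hn
    by_contra h
    apply hn
    rw [Finset.coe_range, Set.mem_Iio, not_lt] at h
    change LTerm n (p i) (toTwistRho1 A (p j)) = 0
    rw [LTerm, inU_divPow_F_smul, hp.F_pow_smul_eq_zero (by omega), smul_zero,
      TensorProduct.zero_tmul, smul_zero]

theorem formTensor_L_of_ne (hA : FLocallyNilpotent k A) (χ : A →ₗ[R k] A →ₗ[R k] R k) {p : ℕ → A}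
    (hp : IsPiString (k := k) p) (hχ : ∀ i j, i ≠ j → χ (p i) (p j) = 0) {i j : ℕ} (hij : i ≠ j) :
    formTensor χ (L hA (p i ⊗ₜ[R k] toTwistRho1 A (p j))) = 0 := by
  rw [formTensor_L hA χ hp]
  refine Finset.sum_eq_zero fun n hn => ?_
  obtain ⟨i, rfl⟩ := Nat.exists_eq_add_of_le (Nat.lt_succ_iff.mp (Finset.mem_range.mp hn))
  rcases lt_or_ge j n with h | h
  · rw [hp.F_pow_smul_eq_zero h, map_zero, mul_zero]
  · obtain ⟨j, rfl⟩ := Nat.exists_eq_add_of_le h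
    rw [hp.F_pow_smul, hp.F_pow_smul, hχ _ _ (by omega), mul_zero]

theorem formTensor_L_self (hA : FLocallyNilpotent k A) (χ : A →ₗ[R k] A →ₗ[R k] R k) {p : ℕ → A}
    (hp : IsPiString (k := k) p) (hχ : ∀ j, χ (p j) (p j) = gramPi k j) (j : ℕ) :
    formTensor χ (L hA (p j ⊗ₜ[R k] toTwistRho1 A (p j))) =
      s k (psiCoeff k j * (psiCoeff k j * gramM k j)) := by
  rw [formTensor_L hA χ hp, ← sum_lCoeff_mul_gramPi,
    Finset.Nat.sum_antidiagonal_eq_sum_range_succ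
      fun n m => algebraMap (RatFunc k) (R k) (lCoeff k n) * gramPi k m]
  refine Finset.sum_congr rfl fun n hn => ?_
  obtain ⟨m, rfl⟩ := Nat.exists_eq_add_of_le (Nat.lt_succ_iff.mp (Finset.mem_range.mp hn))
  rw [hp.F_pow_smul, hχ, Nat.add_sub_cancel_left]

section Comparison

variable {hA : FLocallyNilpotent k A} {χ : A →ₗ[R k] A →ₗ[R k] R k}
  {p : Module.Basis ℕ (R k) A} (hp : IsPiString (k := k) p)
  (hχ : ∀ j, χ (p j) (p j) = gramPi k j) (hχ' : ∀ i j, i ≠ j → χ (p i) (p j) = 0)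
  {B : Type u} [AddCommGroup B] [Module (UR k) B] [Module (R k) B] [IsScalarTower (R k) (UR k) B]
  {b : Module.Basis ℕ (R k) B} {Ψ : Twist (sTprime k : UR k →+* UR k) A ≃ₗ[UR k] B}
  (hΨ : ∀ j, Ψ (toTwist _ _ (p j)) = psiCoeff k j • b j)

theorem map_toTwist_smul (Ψ : Twist (sTprime k : UR k →+* UR k) A ≃ₗ[UR k] B) (r : R k) (a : A) :
    Ψ (toTwist _ _ (r • a)) = s k r • Ψ (toTwist _ _ a) := by
  rw [toTwist_smul, map_smul, algebraMap_smul]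

include hp hχ hχ' hΨ

theorem s_formTensor_L_basis (i j : ℕ) :
    s k (formTensor χ (L hA (p i ⊗ₜ[R k] toTwistRho1 A (p j)))) =
      diagForm b (gramM k) (Ψ (toTwist _ _ (p i))) (Ψ (toTwist _ _ (p j))) := by
  rw [hΨ, hΨ, LinearMap.map_smul₂, LinearMap.map_smul]
  by_cases h : i = j
  · subst h
    rw [formTensor_L_self hA χ hp hχ, s_s, diagForm_self, smul_eq_mul, smul_eq_mul]
  · rw [formTensor_L_of_ne hA χ hp hχ' h, diagForm_of_ne _ _ h, map_zero, smul_zero, smul_zero]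

theorem s_formTensor_L_basis_left (i : ℕ) (y : A) :
    s k (formTensor χ (L hA (p i ⊗ₜ[R k] toTwistRho1 A y))) =
      diagForm b (gramM k) (Ψ (toTwist _ _ (p i))) (Ψ (toTwist _ _ y)) := by
  induction p.mem_span y using Submodule.span_induction with
  | zero => rw [LinearEquiv.map_zero, TensorProduct.tmul_zero, LinearMap.map_zero,
      LinearMap.map_zero, map_zero, map_zero, map_zero, LinearMap.map_zero]
  | add x x' _ _ hx hx' =>
    rw [LinearEquiv.map_add, TensorProduct.tmul_add, LinearMap.map_add, LinearMap.map_add, map_add,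
      hx, hx', map_add, map_add, LinearMap.map_add]
  | smul r x _ hx =>
    rw [LinearEquiv.map_smul, TensorProduct.tmul_smul, LinearMap.map_smul, LinearMap.map_smul,
      smul_eq_mul, map_mul, hx, map_toTwist_smul, LinearMap.map_smul, smul_eq_mul]
  | mem y hy =>
    obtain ⟨j, rfl⟩ := hy
    exact s_formTensor_L_basis hp hχ hχ' hΨ i j

/-- Both sides of the comparison are additive and `s`-semilinear in each variable, so they agree
once they agree on a basis. -/
theorem s_formTensor_L (x y : A) :
    s k (formTensor χ (L hA (x ⊗ₜ[R k] toTwistRho1 A y))) =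
      diagForm b (gramM k) (Ψ (toTwist _ _ x)) (Ψ (toTwist _ _ y)) := by
  induction p.mem_span x using Submodule.span_induction with
  | zero => rw [TensorProduct.zero_tmul, LinearMap.map_zero, LinearMap.map_zero, map_zero, map_zero,
      map_zero, LinearMap.map_zero, LinearMap.zero_apply]
  | add x x' _ _ hx hx' =>
    rw [TensorProduct.add_tmul, LinearMap.map_add, LinearMap.map_add, map_add, hx, hx', map_add,
      map_add, LinearMap.map_add, LinearMap.add_apply]
  | smul r x _ hx =>
    rw [← TensorProduct.smul_tmul', LinearMap.map_smul, LinearMap.map_smul, smul_eq_mul, map_mul, hx,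
      map_toTwist_smul, LinearMap.map_smul₂, smul_eq_mul]
  | mem x hx =>
    obtain ⟨i, rfl⟩ := hx
    exact s_formTensor_L_basis_left hp hχ hχ' hΨ i y

end Comparison

end Lusztig

/-! ### The comparison of the two forms -/

section Final

variable {k : Type u} [Field k] {w : M k}

theorem existsUnique_isShapovalovForm (hw : IsHighestWeightVector w) :
    ∃! φ : M k →ₗ[R k] M k →ₗ[R k] R k, IsShapovalovForm w φ :=
  ⟨_, isShapovalovForm_diagForm hw, fun _ hφ => hφ.eq_diagForm hw⟩

theorem existsUnique_isLift (hw : IsHighestWeightVector w) {φ : M k →ₗ[R k] M k →ₗ[R k] R k}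
    (hφ : IsShapovalovForm w φ) :
    ∃! φF : LocF k (M k) →ₗ[R k] LocF k (M k) →ₗ[R k] R k, IsLift φ φF :=
  ⟨_, isLift_diagForm hw hφ, fun _ h => h.eq_diagForm hw hφ⟩

theorem s_formPi_L (hw : IsHighestWeightVector w) {φ : M k →ₗ[R k] M k →ₗ[R k] R k}
    (hφ : IsShapovalovForm w φ) {Ψ : NondegenerateCycle k (M k)} (hΨ : IsVermaCycle w Ψ)
    {φF : LocF k (M k) →ₗ[R k] LocF k (M k) →ₗ[R k] R k} (hF : IsLift φ φF) (a b : Pi k (M k)) :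
    s k (formTensor hF.formPi (L (fLocallyNilpotent_Pi k (M k)) (a ⊗ₜ[R k] toTwistRho1 _ b))) =
      φ (Ψ (toTwist _ _ a)) (Ψ (toTwist _ _ b)) := by
  refine (s_formTensor_L hw.isPiString (hF.formPi_self hw hφ)
    (fun i j hij => hF.formPi_of_ne hw hφ hij) ((isVermaCycle_iff hw Ψ).mp hΨ) a b).trans ?_
  rw [← hφ.eq_diagForm hw]

theorem sharp_eq (hw : IsHighestWeightVector w) {φ : M k →ₗ[R k] M k →ₗ[R k] R k}
    (hφ : IsShapovalovForm w φ) {Ψ : NondegenerateCycle k (M k)} (hΨ : IsVermaCycle w Ψ)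
    {φF : LocF k (M k) →ₗ[R k] LocF k (M k) →ₗ[R k] R k} (hF : IsLift φ φF) (x y : M k) :
    sharp Ψ hF.formPi x y = φ x y := by
  rw [sharp, s_formPi_L hw hφ hΨ hF, AddEquiv.apply_symm_apply, AddEquiv.apply_symm_apply,
    LinearEquiv.apply_symm_apply, LinearEquiv.apply_symm_apply]

end Final

end QSL2

end

theorem mainTheorem7 {k : Type*} [Field k] [CharZero k]
    (w : QSL2.M k) (hw : QSL2.IsHighestWeightVector w) :
    (∃! φ : QSL2.M k →ₗ[QSL2.R k] QSL2.M k →ₗ[QSL2.R k] QSL2.R k, QSL2.IsShapovalovForm w φ) ∧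
    (∃! Ψ : QSL2.NondegenerateCycle k (QSL2.M k), QSL2.IsVermaCycle w Ψ) ∧
    ∀ φ : QSL2.M k →ₗ[QSL2.R k] QSL2.M k →ₗ[QSL2.R k] QSL2.R k, QSL2.IsShapovalovForm w φ →
    ∀ Ψ : QSL2.NondegenerateCycle k (QSL2.M k), QSL2.IsVermaCycle w Ψ →
      (∃! φF : QSL2.LocF k (QSL2.M k) →ₗ[QSL2.R k] QSL2.LocF k (QSL2.M k) →ₗ[QSL2.R k] QSL2.R k,
        QSL2.IsLift φ φF) ∧
      ∀ (φF : QSL2.LocF k (QSL2.M k) →ₗ[QSL2.R k] QSL2.LocF k (QSL2.M k) →ₗ[QSL2.R k] QSL2.R k)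
        (hF : QSL2.IsLift φ φF),
        (∀ a b : QSL2.Pi k (QSL2.M k),
          QSL2.s k (QSL2.formTensor hF.formPi
              (QSL2.L (QSL2.fLocallyNilpotent_Pi k (QSL2.M k))
                (a ⊗ₜ[QSL2.R k] QSL2.toTwistRho1 _ b)))
            = φ (Ψ (QSL2.toTwist _ _ a)) (Ψ (QSL2.toTwist _ _ b))) ∧
        (∀ x y : QSL2.M k, QSL2.sharp Ψ hF.formPi x y = φ x y) := by
  refine ⟨QSL2.existsUnique_isShapovalovForm hw, QSL2.existsUnique_isVermaCycle hw,
    fun φ hφ Ψ hΨ => ⟨QSL2.existsUnique_isLift hw hφ, fun φF hF => ⟨?_, ?_⟩⟩⟩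
  · exact QSL2.s_formPi_L hw hφ hΨ hF
  · exact QSL2.sharp_eq hw hφ hΨ hF
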